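/- All vector spaces are over $\mathbb{C}$ and $\mathbb{N}=\{0,1,2,\dots\}$. **Definitions.** A *1-truncated conformal algebra* is a graded vector space $\mathbb{A}\oplus\mathbb{B}$ ($\mathbb{A}$ in degree $0$, $\mathbb{B}$ in degree $1$) with a linear map $\partial:\mathbb{A}\to\mathbb{B}$ and bilinear operations $(u,v)\mapsto u_iv$ ($i=0,1$) of degree $-i-1$ such that, for $a\in\mathbb{A}$, $u,v\in\mathbb{B}$, $\alpha,\beta,\gamma\in\mathbb{A}\oplus\mathbb{B}$, $i=0,1$: $(\partial a)_0=0$, $(\partial a)_1=-a_0$, $\partial(u_0a)=u_0\partial a$; $u_0a=-a_0u$, $u_0v=-v_0u+\partial(v_1u)$, $u_1v=v_1u$; $\alpha_0\beta_i\gamma=\beta_i\alpha_0\gamma+(\alpha_0\beta)_i\gamma$. Put $u_iv=0$ for $i\ge 2$. A *vertex Poisson algebra* is a commutative associative unital algebra $S$ with a derivation $\partial$ and a linear map $a\mapsto Y_-(a,x)=\sum_{n\in\mathbb{N}}a_nx^{-n-1}$, $a_n\in\mathrm{End}\,S$, such that for $a,b,c\in S$, $m,n\in\mathbb{N}$: $a_nb=0$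 for $n$ large; $(\partial a)_nb=-na_{n-1}b$; $a_nb=\sum_{i\ge0}(-1)^{n+i+1}\frac1{i!}\partial^i(b_{n+i}a)$; $a_mb_nc-b_na_mc=\sum_{i=0}^m\binom mi(a_ib)_{m+n-i}c$; $a_n(bc)=(a_nb)c+b(a_nc)$. It is *$\mathbb{N}$-graded* if $S=\coprod_{n\in\mathbb{N}}S_{(n)}$ as a graded algebra, with $\partial S_{(r)}\subset S_{(r+1)}$ and $a_mS_{(r)}\subset S_{(r+n-m-1)}$ for $a\in S_{(n)}$, $n,r,m\in\mathbb{N}$, where $S_{(k)}=0$ for $k<0$. **Construction.** Let $\mathbb{A}\oplus\mathbb{B}$ be a 1-truncated conformal algebra. Let $C(\mathbb{A}\oplus\mathbb{B})=\mathbb{C}[\mathcal{D}]\otimes(\mathbb{A}\oplus\mathbb{B})$, with the operator $\mathcal{D}(\mathcal{D}^n\otimes u)=\mathcal{D}^{n+1}\otimes u$, graded by $\deg(\mathcal{D}^n\otimes a)=n$, $\deg(\mathcal{D}^n\otimes b)=n+1$ for $a\in\mathbb{A}$, $b\in\mathbb{B}$. Let $\mathcal{C}$ be its quotient by the subspace $\{(1\otimes\partial-\mathcal{D}\otimes1)p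 : p\in\mathbb{C}[\mathcal{D}]\otimes\mathbb{A}\}$, with the induced operator $\mathcal{D}$ and the induced homogeneous subspaces $\mathcal{C}_{(n)}$; write $\mathcal{D}^nu$ for the class of $\mathcal{D}^n\otimes u$. Define bilinear products $p_nq$ ($n\in\mathbb{N}$) on $C(\mathbb{A}\oplus\mathbb{B})$ by, for $u,v\in\mathbb{A}\oplus\mathbb{B}$, $k\ge0$, $$(1\otimes u)_n(\mathcal{D}^k\otimes v)=\sum_{p=0}^{\min(k,n)}\binom kp\frac{n!}{(n-p)!}\,\mathcal{D}^{k-p}\otimes u_{n-p}v,$$ and for $m\ge1$ $$(\mathcal{D}^m\otimes u)_n(\mathcal{D}^k\otimes v)=\sum_{i\ge0,\ n+i\ge k}\frac{(-1)^{n+i+1+k}}{i!}\frac{(n+i)!}{(n+i-k)!}\,\mathcal{D}^i\big((1\otimes v)_{n+i-k}(\mathcal{D}^m\otimes u)\big).$$ Let $S(\mathcal{C})$ be the symmetric algebra of $\mathcal{C}$, let $\mathcal{D}$ also denote the derivation of $S(\mathcal{C})$ extending $\mathcal{D}$ on $\mathcal{C}$, and let $S(\mathcal{C})_{(n)}$ be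 the span of all products $c_1\cdots c_k$ with $k\ge0$, $c_i\in\mathcal{C}_{(e_i)}$, $e_1+\dots+e_k=n$. **Theorem.** There is exactly one vertex Poisson algebra structure on the differential algebra $(S(\mathcal{C}),\mathcal{D})$ for which $\bar p_n\bar q=\overline{p_nq}$ for all $p,q\in C(\mathbb{A}\oplus\mathbb{B})$ and $n\in\mathbb{N}$, where the bar denotes the class in $\mathcal{C}\subset S(\mathcal{C})$. With this structure and the subspaces $S(\mathcal{C})_{(n)}$, $(S(\mathcal{C}),\mathcal{D})$ is an $\mathbb{N}$-graded vertex Poisson algebra. Moreover, the algebra homomorphism $S(\mathbb{A})\to S(\mathcal{C})$ induced by $\mathbb{A}\to\mathcal{C}$ is injective with image $S(\mathcal{C})_{(0)}$, and for $n\ge1$ $$S(\mathcal{C})_{(n)}=\mathrm{span}_{\mathbb{C}}\{\mathcal{D}^{n_1}b_1\cdots\mathcal{D}^{n_k}b_k\cdot a_1\cdots a_l : b_i\in\mathbb{B},\ a_j\in\mathbb{A},\ l\ge0,\ k\ge1,\ n_1\ge\dots\ge n_k\ge0,\ n_1+\dots+n_k+k=n\}.$$ -/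

import Mathlib

open scoped TensorProduct

noncomputable section

/-! ### Vertex Poisson algebras -/

/-- A vertex Lie algebra structure on the complex vector space `V` with linear operator `d`,
in components: `Y n a b` is `a_n b`, and `Y_-(a,x) = ∑_{n ≥ 0} a_n x^{-n-1}`. -/
structure IsVertexLieAlgebra {V : Type*} [AddCommGroup V] [Module ℂ V]
    (d : V →ₗ[ℂ] V) (Y : ℕ → V →ₗ[ℂ] V →ₗ[ℂ] V) : Prop where
  /-- `a_n b = 0` for `n` sufficiently large. -/
  truncation : ∀ a b : V, ∃ N : ℕ, ∀ n : ℕ, N ≤ n → Y n a b = 0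
  /-- `Y_-(d a, x) = d/dx Y_-(a, x)`, that is, `(d a)_n b = - n a_{n-1} b`
  (for `n = 0` the right-hand side is zero). -/
  derivative : ∀ (n : ℕ) (a b : V), Y n (d a) b = -((n : ℂ) • Y (n - 1) a b)
  /-- Half skew symmetry `Y_-(a,x) b = Sing (e^{x d} Y_-(b,-x) a)`. The sum is finite
  because of `truncation`. -/
  skew : ∀ (n : ℕ) (a b : V),
    Y n a b = ∑ᶠ i : ℕ, ((-1 : ℂ) ^ (n + i + 1) * ((Nat.factorial i : ℂ))⁻¹) •
      (d ^ i) (Y (n + i) b a)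
  /-- The half commutator formula
  `[Y_-(a,x_1), Y_-(b,x_2)] = Sing (Y_-(Y_-(a,x_1-x_2) b, x_2))`. -/
  commutator : ∀ (m n : ℕ) (a b c : V),
    Y m a (Y n b c) - Y n b (Y m a c) =
      ∑ i ∈ Finset.range (m + 1), (Nat.choose m i : ℂ) • Y (m + n - i) (Y i a b) c

/-- A vertex Poisson algebra structure on the differential algebra `(S, d)`. -/
structure IsVertexPoissonAlgebra {S : Type*} [CommRing S] [Algebra ℂ S]
    (d : Derivation ℂ S S) (Y : ℕ → S →ₗ[ℂ] S →ₗ[ℂ] S) : Prop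
    extends IsVertexLieAlgebra (d : S →ₗ[ℂ] S) Y where
  /-- `Y_-(a,x)(b c) = (Y_-(a,x) b) c + b (Y_-(a,x) c)`. -/
  leibniz : ∀ (n : ℕ) (a b c : S), Y n a (b * c) = Y n a b * c + b * Y n a c

/-- An `ℕ`-graded vertex Poisson algebra: a vertex Poisson algebra with a decomposition
`S = ⨁ n, 𝒮 n`, as an algebra, with `d (𝒮 r) ⊆ 𝒮 (r+1)` and
`a_m (𝒮 r) ⊆ 𝒮 (r+n-m-1)` for `a ∈ 𝒮 n`, where `𝒮 k = 0` for `k < 0`. -/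
structure IsNGradedVertexPoissonAlgebra {S : Type*} [CommRing S] [Algebra ℂ S]
    (d : Derivation ℂ S S) (Y : ℕ → S →ₗ[ℂ] S →ₗ[ℂ] S) (𝒮 : ℕ → Submodule ℂ S) : Prop
    extends IsVertexPoissonAlgebra d Y where
  isInternal : DirectSum.IsInternal 𝒮
  one_mem : (1 : S) ∈ 𝒮 0
  mul_mem : ∀ (r s : ℕ) (a b : S), a ∈ 𝒮 r → b ∈ 𝒮 s → a * b ∈ 𝒮 (r + s)
  d_mem : ∀ (r : ℕ) (a : S), a ∈ 𝒮 r → d a ∈ 𝒮 (r + 1)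
  prod_mem : ∀ (n r m k : ℕ) (a b : S), a ∈ 𝒮 n → b ∈ 𝒮 r → r + n = k + m + 1 →
    Y m a b ∈ 𝒮 k
  prod_eq_zero : ∀ (n r m : ℕ) (a b : S), a ∈ 𝒮 n → b ∈ 𝒮 r → r + n < m + 1 →
    Y m a b = 0

/-! ### 1-truncated conformal algebras -/

/-- A 1-truncated conformal algebra structure on the graded vector space `A ⊕ B`
(`A` in degree `0`, `B` in degree `1`): a linear map `d : A → B` and bilinear operations
`op0 u v = u_0 v`, `op1 u v = u_1 v` of degrees `-1` and `-2`. Elements `a` of `A` and `u` of `B`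
are written `(a, 0)` and `(0, u)`. -/
structure OneTruncatedConformalAlgebra (A B : Type*) [AddCommGroup A] [Module ℂ A]
    [AddCommGroup B] [Module ℂ B] where
  d : A →ₗ[ℂ] B
  op0 : (A × B) →ₗ[ℂ] (A × B) →ₗ[ℂ] (A × B)
  op1 : (A × B) →ₗ[ℂ] (A × B) →ₗ[ℂ] (A × B)
  -- `op0` has degree `-1`
  op0_AA : ∀ a a' : A, op0 (a, 0) (a', 0) = 0
  op0_AB : ∀ (a : A) (u : B), (op0 (a, 0) (0, u)).2 = 0
  op0_BA : ∀ (u : B) (a : A), (op0 (0, u) (a, 0)).2 = 0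
  op0_BB : ∀ u v : B, (op0 (0, u) (0, v)).1 = 0
  -- `op1` has degree `-2`
  op1_AA : ∀ a a' : A, op1 (a, 0) (a', 0) = 0
  op1_AB : ∀ (a : A) (u : B), op1 (a, 0) (0, u) = 0
  op1_BA : ∀ (u : B) (a : A), op1 (0, u) (a, 0) = 0
  op1_BB : ∀ u v : B, (op1 (0, u) (0, v)).2 = 0
  -- derivation
  d_op0 : ∀ (a : A) (w : A × B), op0 (0, d a) w = 0
  d_op1 : ∀ (a : A) (w : A × B), op1 (0, d a) w = -op0 (a, 0) w
  d_comm : ∀ (u : B) (a : A), (0, d (op0 (0, u) (a, 0)).1) = op0 (0, u) (0, d a)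
  -- commutativity
  comm_BA : ∀ (u : B) (a : A), op0 (0, u) (a, 0) = -op0 (a, 0) (0, u)
  comm_BB : ∀ u v : B,
    op0 (0, u) (0, v) = -op0 (0, v) (0, u) + (0, d (op1 (0, v) (0, u)).1)
  comm1_BB : ∀ u v : B, op1 (0, u) (0, v) = op1 (0, v) (0, u)
  -- associativity
  assoc0 : ∀ α β γ : A × B, op0 α (op0 β γ) = op0 β (op0 α γ) + op0 (op0 α β) γ
  assoc1 : ∀ α β γ : A × B, op0 α (op1 β γ) = op1 β (op0 α γ) + op1 (op0 α β) γ

namespace OneTruncatedConformalAlgebra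

/-! ### The free `ℂ[D]`-module on `A ⊕ B` -/

section Free

variable (A B : Type*) [AddCommGroup A] [Module ℂ A] [AddCommGroup B] [Module ℂ B]

/-- `C(A ⊕ B) = ℂ[D] ⊗ (A ⊕ B)`. -/
abbrev FreeC : Type _ := Polynomial ℂ ⊗[ℂ] (A × B)

/-- `u ↦ D^k ⊗ u`. -/
def mon (k : ℕ) : (A × B) →ₗ[ℂ] FreeC A B :=
  TensorProduct.mk ℂ (Polynomial ℂ) (A × B) (Polynomial.X ^ k)

/-- The operator `D` on `C(A ⊕ B)`, with `D (D^k ⊗ u) = D^{k+1} ⊗ u`. -/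
def freeD : FreeC A B →ₗ[ℂ] FreeC A B :=
  LinearMap.rTensor (A × B) (LinearMap.mulLeft ℂ (Polynomial.X : Polynomial ℂ))

variable {A B}

/-- The linear map on `C(A ⊕ B)` with prescribed values `D^k ⊗ u ↦ g k u`. -/
def extendMon {M : Type*} [AddCommMonoid M] [Module ℂ M] (g : ℕ → (A × B) →ₗ[ℂ] M) :
    FreeC A B →ₗ[ℂ] M :=
  TensorProduct.lift (Polynomial.lsum fun k =>
    LinearMap.toSpanSingleton ℂ ((A × B) →ₗ[ℂ] M) (g k))

theorem extendMon_mon {M : Type*} [AddCommMonoid M] [Module ℂ M]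
    (g : ℕ → (A × B) →ₗ[ℂ] M) (k : ℕ) (u : A × B) :
    extendMon g (mon A B k u) = g k u := by
  simp [extendMon, mon, Polynomial.lsum_apply,
    ← Polynomial.monomial_one_right_eq_X_pow, Polynomial.sum_monomial_index]

theorem freeD_mon (k : ℕ) (u : A × B) : freeD A B (mon A B k u) = mon A B (k + 1) u := by
  simp [freeD, mon, pow_succ']

variable (A B)

/-- The homogeneous subspaces of `C(A ⊕ B)`, with `deg (D^n ⊗ a) = n` and
`deg (D^n ⊗ b) = n + 1`. -/
def freeGrade : ℕ → Submodule ℂ (FreeC A B)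
  | 0 => LinearMap.range (mon A B 0 ∘ₗ LinearMap.inl ℂ A B)
  | n + 1 => LinearMap.range (mon A B (n + 1) ∘ₗ LinearMap.inl ℂ A B) ⊔
      LinearMap.range (mon A B n ∘ₗ LinearMap.inr ℂ A B)

end Free

variable {A B : Type*} [AddCommGroup A] [Module ℂ A] [AddCommGroup B] [Module ℂ B]
variable (T : OneTruncatedConformalAlgebra A B)

/-! ### The products `Y^0_-` on `C(A ⊕ B)` -/

/-- `u_n v` for `u, v ∈ A ⊕ B`; only `u_0 v` and `u_1 v` can be nonzero. -/
def op : ℕ → (A × B) →ₗ[ℂ] (A × B) →ₗ[ℂ] (A × B)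
  | 0 => T.op0
  | 1 => T.op1
  | _ + 2 => 0

/-- `u_n (D^k ⊗ v)` for `u, v ∈ A ⊕ B`, as prescribed by
`Y^0_-(u,x) e^{x_1 D} v = e^{x_1 D} e^{-x_1 d/dx} Y^0_-(u,x) v`, which says
`u_n (D^k ⊗ v) = ∑_p binom(k,p) n (n-1) ⋯ (n-p+1) D^{k-p} ⊗ u_{n-p} v`
(the coefficient is zero when `p > n`). -/
def act0 (n k : ℕ) : (A × B) →ₗ[ℂ] (A × B) →ₗ[ℂ] FreeC A B :=
  ∑ p ∈ Finset.range (k + 1),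
    ((Nat.choose k p * Nat.descFactorial n p : ℕ) : ℂ) •
      (T.op (n - p)).compr₂ (mon A B (k - p))

/-- `(D^m ⊗ u)_n (D^k ⊗ v)` for `u, v ∈ A ⊕ B`. For `m ≥ 1` this is the coefficient of
`x^{-n-1}` in `Sing (e^{x D} (-d/dx)^k Y^0_-(v,-x) (D^m ⊗ u))`, namely
`∑_i (-1)^{n+i+1+k} / i! * (n+i) (n+i-1) ⋯ (n+i-k+1) D^i (v_{n+i-k} (D^m ⊗ u))`.
The terms with `n + i - k > m + 1` vanish, so the sum over `i` may stop at `m + k + 1`. -/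
def act (n : ℕ) : ℕ → ℕ → (A × B) →ₗ[ℂ] (A × B) →ₗ[ℂ] FreeC A B
  | 0, k => T.act0 n k
  | m + 1, k =>
    ∑ i ∈ Finset.range (m + 1 + k + 2),
      ((-1 : ℂ) ^ (n + i + 1 + k) * (Nat.descFactorial (n + i) k : ℂ) *
          ((Nat.factorial i : ℂ))⁻¹) •
        ((T.act0 (n + i - k) (m + 1)).flip).compr₂ (freeD A B ^ i)

/-- `Y^0_-` on `C(A ⊕ B)`: `T.Y0 n p q` is `p_n q`. -/
def Y0 (n : ℕ) : FreeC A B →ₗ[ℂ] FreeC A B →ₗ[ℂ] FreeC A B :=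
  extendMon fun m => (extendMon fun k => (T.act n m k).flip).flip

theorem Y0_mon (n m k : ℕ) (u v : A × B) :
    T.Y0 n (mon A B m u) (mon A B k v) = T.act n m k u v := by
  simp [Y0, extendMon_mon]

/-! ### The quotient `𝒞` -/

/-- `1 ⊗ d - D ⊗ 1 : C(A) → C(A ⊕ B)`, where `C(A) = ℂ[D] ⊗ A`. -/
def dHat : Polynomial ℂ ⊗[ℂ] A →ₗ[ℂ] FreeC A B :=
  LinearMap.lTensor (Polynomial ℂ) (LinearMap.inr ℂ A B ∘ₗ T.d) -
    freeD A B ∘ₗ LinearMap.lTensor (Polynomial ℂ) (LinearMap.inl ℂ A B)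

/-- `𝒞 = C(A ⊕ B) / (1 ⊗ d - D ⊗ 1) C(A)`. -/
abbrev QuotC : Type _ := FreeC A B ⧸ LinearMap.range T.dHat

theorem range_dHat_le_comap :
    LinearMap.range T.dHat ≤ (LinearMap.range T.dHat).comap (freeD A B) := by
  rintro _ ⟨x, rfl⟩
  refine ⟨LinearMap.rTensor A (LinearMap.mulLeft ℂ (Polynomial.X : Polynomial ℂ)) x, ?_⟩
  induction x with
  | zero => simp
  | tmul f a => simp [dHat, freeD]
  | add x y hx hy => simp only [map_add, hx, hy]

/-- The projection `ρ : C(A ⊕ B) → 𝒞`. -/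
def proj : FreeC A B →ₗ[ℂ] T.QuotC := (LinearMap.range T.dHat).mkQ

/-- The operator `D` on `𝒞`. -/
def quotD : T.QuotC →ₗ[ℂ] T.QuotC :=
  (LinearMap.range T.dHat).mapQ (LinearMap.range T.dHat) (freeD A B) T.range_dHat_le_comap

/-- The homogeneous subspaces `𝒞_(n)`. -/
def quotGrade (n : ℕ) : Submodule ℂ T.QuotC := (freeGrade A B n).map T.proj

/-! ### The symmetric algebra `S(𝒞)` -/

/-- The symmetric algebra `S(𝒞)`. -/
abbrev SymC : Type _ := SymmetricAlgebra ℂ T.QuotC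

/-- The algebra homomorphism `s ↦ s + ε D s` from `S(𝒞)` to the dual numbers over `S(𝒞)`. -/
def symDHom : T.SymC →ₐ[ℂ] TrivSqZeroExt T.SymC T.SymC :=
  SymmetricAlgebra.lift
    ((TrivSqZeroExt.inlAlgHom ℂ T.SymC T.SymC).toLinearMap ∘ₗ SymmetricAlgebra.ι ℂ T.QuotC +
      (TrivSqZeroExt.inrHom T.SymC T.SymC).restrictScalars ℂ ∘ₗ
        SymmetricAlgebra.ι ℂ T.QuotC ∘ₗ T.quotD)

theorem fst_symDHom (s : T.SymC) : (T.symDHom s).fst = s := by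
  have h : (TrivSqZeroExt.fstHom ℂ T.SymC T.SymC).comp T.symDHom = AlgHom.id ℂ T.SymC := by
    apply SymmetricAlgebra.algHom_ext
    refine LinearMap.ext fun x => ?_
    simp [symDHom]
  exact congrArg (fun f : T.SymC →ₐ[ℂ] T.SymC => f s) h

/-- The derivation `D` of `S(𝒞)` that extends the operator `D` on `𝒞`. -/
def symD : Derivation ℂ T.SymC T.SymC :=
  Derivation.mk' ((TrivSqZeroExt.sndHom T.SymC T.SymC).restrictScalars ℂ ∘ₗ
      T.symDHom.toLinearMap) (by
    intro a b
    simp [fst_symDHom, mul_comm])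

theorem symD_ι (c : T.QuotC) :
    T.symD (SymmetricAlgebra.ι ℂ T.QuotC c) = SymmetricAlgebra.ι ℂ T.QuotC (T.quotD c) := by
  simp [symD, symDHom]

/-- The homogeneous subspace `S(𝒞)_(n)`: the span of all products `c_1 ⋯ c_k` (`k ≥ 0`) with
`c_i ∈ 𝒞_(e_i)` and `e_1 + ⋯ + e_k = n`. -/
def symGrade (n : ℕ) : Submodule ℂ T.SymC :=
  Submodule.span ℂ {s | ∃ (k : ℕ) (e : Fin k → ℕ) (c : Fin k → T.QuotC),
    (∀ i, c i ∈ T.quotGrade (e i)) ∧ ∑ i, e i = n ∧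
      s = ∏ i, SymmetricAlgebra.ι ℂ T.QuotC (c i)}

/-- The element `a ∈ A` inside `S(𝒞)`. -/
def inA : A →ₗ[ℂ] T.SymC :=
  SymmetricAlgebra.ι ℂ T.QuotC ∘ₗ T.proj ∘ₗ mon A B 0 ∘ₗ LinearMap.inl ℂ A B

/-- The element `D^n b` of `S(𝒞)` for `b ∈ B`. -/
def inB (n : ℕ) : B →ₗ[ℂ] T.SymC :=
  SymmetricAlgebra.ι ℂ T.QuotC ∘ₗ T.proj ∘ₗ mon A B n ∘ₗ LinearMap.inr ℂ A B

/-- The products `Y` on `S(𝒞)` extend `Y^0_-`: for `p, q ∈ C(A ⊕ B)` with classes `ρ p, ρ q` in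
`𝒞 ⊆ S(𝒞)`, one has `(ρ p)_n (ρ q) = ρ (p_n q)`. -/
def ExtendsY0 (Y : ℕ → T.SymC →ₗ[ℂ] T.SymC →ₗ[ℂ] T.SymC) : Prop :=
  ∀ (n : ℕ) (p q : FreeC A B),
    Y n (SymmetricAlgebra.ι ℂ T.QuotC (T.proj p)) (SymmetricAlgebra.ι ℂ T.QuotC (T.proj q)) =
      SymmetricAlgebra.ι ℂ T.QuotC (T.proj (T.Y0 n p q))

end OneTruncatedConformalAlgebra

end

/-! # The vertex Poisson algebra of a 1-truncated conformal algebra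

Polar parts `∑ φ_n x^{-n-1}` over a vector space `V` are encoded as finitely supported sequences
`ℕ →₀ V`, viewed as `V((x)) / V[[x]]`. Power series of operators act on them (`seriesAct`, a ring
action), and half skew symmetry reads `Y_-(a) b = skewFlip (Y_-(b) a)`, where
`skewFlip φ = Sing (e^{xD} φ(-x))` is an involution (`skewFlip_skewFlip`), because
`e^{xD} e^{-xD} = 1`. It exchanges the operators `d/dx` and `D - d/dx`.

On `𝒞` the bracket is the sesquilinear extension of `u_0 v x^{-1} + u_1 v x^{-2}` from `A ⊕ B`: `D`
acts as `d/dx` on the left and as `D - d/dx` on the right. The axioms on `∂` say that it respects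
the relations `D a = ∂a`, and its skew symmetry has to be checked only on `A ⊕ B`; skew symmetry
also identifies it with the given products on `C(A ⊕ B)` (`bracket_apply`).

For a generator `c`, `Y_-(c)` extends to a derivation of `S(𝒞)`. Half skew symmetry then forces
`Y_-(s) c = skewFlip (Y_-(c) s)`, and `Y_-(s)` is the derivation with these values on generators
(`PolarBracket.pois`). As the flip turns multiplication by `s` into multiplication by `e^{xD} s`
(`skewFlip_smul`), this bracket satisfies a right Leibniz rule (`pois_mul_left`), from which its
skew symmetry and sesquilinearity follow by induction on products.

The defect `jac` of the half commutator formula `[a_m, b_n] = ∑ binom(m,i) (a_i b)_{m+n-i}` is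
a derivation in `c`, satisfies the right Leibniz rule in `b`, and is compatible with `D` in both.
On `A ⊕ B` it vanishes by the associativity axioms (`op_commutator`), hence for `a` and `b` in
`A ⊕ B` and all `c`, hence for `a` in `A ⊕ B` and all `b`, `c`. By skew symmetry its vanishing is
symmetric in `a` and `b` (`jac_swap`), so the roles may be exchanged and the extension in `b`
repeated (`jac_eq_zero`). Uniqueness holds because the Leibniz rule and skew symmetry determine
all products from those of generators.

The grading of `S(𝒞)` comes from the algebra homomorphism `coaction : S(𝒞) → S(𝒞)[t]`,
`c ↦ c t^n` for `c ∈ 𝒞_(n)`. A retraction `𝒞 → A` splits `S(A) → S(𝒞)`, and the spanning set in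
positive degrees reflects that `𝒞_(0)` is the image of `A` and `𝒞_(n+1)` that of `D^n B`. -/

noncomputable section

/-! ### Power series of operators acting on polar parts -/

namespace PolarPart

open Finset PowerSeries

variable {V : Type*} [AddCommGroup V] [Module ℂ V]

/-- The action of `V`-endomorphism-valued power series on polar parts. A finitely supported
sequence `φ : ℕ →₀ V` encodes the polar part `∑ φ_n x^{-n-1}`, an element of
`V((x)) / V[[x]]`; the series `∑ A_i x^i` sends it to the polar part of the product, whose
`n`-th coefficient is `∑_i A_i φ_{n+i}`. -/
def seriesAct (A : (Module.End ℂ V)⟦X⟧) : Module.End ℂ (ℕ →₀ V) :=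
  Finsupp.lsum ℂ fun k => ∑ p ∈ antidiagonal k, Finsupp.lsingle p.2 ∘ₗ coeff p.1 A

theorem seriesAct_single (A : (Module.End ℂ V)⟦X⟧) (k : ℕ) (v : V) :
    seriesAct A (Finsupp.single k v) =
      ∑ p ∈ antidiagonal k, Finsupp.single p.2 (coeff p.1 A v) := by
  simp [seriesAct]

theorem seriesAct_single_apply (A : (Module.End ℂ V)⟦X⟧) (k n : ℕ) (v : V) :
    seriesAct A (Finsupp.single k v) n = if n ≤ k then coeff (k - n) A v else 0 := by
  rw [seriesAct_single, Finsupp.finsetSum_apply]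
  split_ifs with h
  · rw [Finset.sum_eq_single (k - n, n)]
    · simp
    · rintro ⟨i, j⟩ hp hne
      rw [HasAntidiagonal.mem_antidiagonal] at hp
      have : j ≠ n := by
        rintro rfl
        exact hne (by ext <;> simp; omega)
      simp [this]
    · intro hn
      exact absurd (HasAntidiagonal.mem_antidiagonal.2 (by simp; omega)) hn
  · refine Finset.sum_eq_zero ?_
    rintro ⟨i, j⟩ hp
    rw [HasAntidiagonal.mem_antidiagonal] at hp
    have : j ≠ n := by simp at hp; omega
    simp [this]

theorem seriesAct_mul (A B : (Module.End ℂ V)⟦X⟧) :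
    seriesAct (A * B) = seriesAct A * seriesAct B := by
  refine Finsupp.lhom_ext fun k v => ?_
  simp only [Module.End.mul_apply, seriesAct_single, map_sum, coeff_mul, LinearMap.sum_apply,
    Finsupp.single_finsetSum]
  rw [Finset.sum_sigma', Finset.sum_sigma']
  refine Finset.sum_nbij' (fun s => ⟨(s.2.2, s.2.1 + s.1.2), (s.2.1, s.1.2)⟩)
    (fun s => ⟨(s.2.1 + s.1.1, s.2.2), (s.2.1, s.1.1)⟩) ?_ ?_ ?_ ?_ ?_
  · rintro ⟨⟨a, b⟩, ⟨c, e⟩⟩ h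
    simp at h ⊢
    omega
  · rintro ⟨⟨a, b⟩, ⟨c, e⟩⟩ h
    simp at h ⊢
    omega
  · rintro ⟨⟨a, b⟩, ⟨c, e⟩⟩ h
    simp at h ⊢
    omega
  · rintro ⟨⟨a, b⟩, ⟨c, e⟩⟩ h
    simp at h ⊢
    omega
  · rintro ⟨⟨a, b⟩, ⟨c, e⟩⟩ h
    rfl

theorem seriesAct_add (A B : (Module.End ℂ V)⟦X⟧) :
    seriesAct (A + B) = seriesAct A + seriesAct B := by
  refine Finsupp.lhom_ext fun k v => ?_
  simp [seriesAct_single, Finset.sum_add_distrib]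

theorem seriesAct_smul (r : ℂ) (A : (Module.End ℂ V)⟦X⟧) :
    seriesAct (r • A) = r • seriesAct A := by
  refine Finsupp.lhom_ext fun k v => ?_
  simp [seriesAct_single, Finset.smul_sum]

theorem seriesAct_zero : seriesAct (0 : (Module.End ℂ V)⟦X⟧) = 0 := by
  refine Finsupp.lhom_ext fun k v => ?_
  simp [seriesAct_single]

theorem seriesAct_sum {ι : Type*} (s : Finset ι) (A : ι → (Module.End ℂ V)⟦X⟧) :
    seriesAct (∑ i ∈ s, A i) = ∑ i ∈ s, seriesAct (A i) := by
  classical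
  induction s using Finset.induction_on with
  | empty => simp [seriesAct_zero]
  | insert i s hi ih => simp [Finset.sum_insert hi, seriesAct_add, ih]

theorem seriesAct_one : seriesAct (1 : (Module.End ℂ V)⟦X⟧) = 1 := by
  refine Finsupp.lhom_ext fun k v => Finsupp.ext fun n => ?_
  rw [seriesAct_single_apply]
  rcases lt_trichotomy n k with h | rfl | h
  · have : k - n ≠ 0 := by omega
    simp [h.le, coeff_one, this, h.ne']
  · simp
  · simp [h.not_ge, h.ne]

/-- A constant series acts on polar parts coefficientwise. -/
theorem seriesAct_C_apply (f : Module.End ℂ V) (φ : ℕ →₀ V) (n : ℕ) :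
    seriesAct (C f) φ n = f (φ n) := by
  induction φ using Finsupp.induction_linear with
  | zero => simp
  | add x y hx hy => simp [hx, hy]
  | single k v =>
    rw [seriesAct_single_apply]
    rcases lt_trichotomy n k with h | rfl | h
    · have : k - n ≠ 0 := by omega
      simp [h.le, coeff_C, this, h.ne']
    · simp
    · simp [h.not_ge, h.ne]

/-- Multiplication by `x^p` shifts the coefficients of a polar part. -/
theorem seriesAct_X_pow_apply (p : ℕ) (φ : ℕ →₀ V) (n : ℕ) :
    seriesAct ((X : (Module.End ℂ V)⟦X⟧) ^ p) φ n = φ (n + p) := by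
  induction φ using Finsupp.induction_linear with
  | zero => simp
  | add x y hx hy => simp [hx, hy]
  | single k v =>
    rw [seriesAct_single_apply, coeff_X_pow, Finsupp.single_apply]
    by_cases h : k = n + p
    · simp [h]
    · by_cases h' : n ≤ k
      · have : k - n ≠ p := by omega
        simp [h, h', this]
      · simp [h, h']

/-- The locally finite formula for the coefficients of `A · φ`. -/
theorem seriesAct_apply (A : (Module.End ℂ V)⟦X⟧) (φ : ℕ →₀ V) (n : ℕ) :
    seriesAct A φ n = ∑ᶠ i : ℕ, coeff i A (φ (n + i)) := by
  have hfin : ∀ ψ : ℕ →₀ V, (Function.support fun i : ℕ => coeff i A (ψ (n + i))).Finite := by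
    intro ψ
    refine ((ψ.support.finite_toSet).preimage (f := fun i => n + i)
      (fun a _ b _ h => by simpa using h)).subset fun i hi => ?_
    simp only [Set.mem_preimage, Finset.mem_coe, Finsupp.mem_support_iff]
    intro h
    simp [h] at hi
  induction φ using Finsupp.induction_linear with
  | zero => simp
  | add x y hx hy =>
    simp only [map_add, Finsupp.add_apply, hx, hy]
    rw [finsum_add_distrib (hfin x) (hfin y)]
  | single k v =>
    rw [seriesAct_single_apply]
    split_ifs with h
    · rw [finsum_eq_single _ (k - n)]
      · simp [h]
      · intro i hi
        have : k ≠ n + i := by omega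
        simp [this]
    · symm
      refine finsum_eq_zero_of_forall_eq_zero fun i => ?_
      have : k ≠ n + i := by omega
      simp [this]

/-! ### Exponential, derivative and half skew symmetry on polar parts -/

/-- The exponential series `e^{x d} = ∑ x^i d^i / i!`. -/
def expSeries (d : Module.End ℂ V) : (Module.End ℂ V)⟦X⟧ :=
  PowerSeries.mk fun i => ((i.factorial : ℂ)⁻¹) • d ^ i

theorem coeff_expSeries (d : Module.End ℂ V) (i : ℕ) :
    coeff i (expSeries d) = ((i.factorial : ℂ)⁻¹) • d ^ i := coeff_mk _ _

theorem expSeries_mul_expSeries_neg (d : Module.End ℂ V) :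
    expSeries d * expSeries (-d) = 1 := by
  ext1 n
  rw [coeff_mul, coeff_one]
  have key : ∑ p ∈ antidiagonal n, coeff p.1 (expSeries d) * coeff p.2 (expSeries (-d)) =
      ((n.factorial : ℂ)⁻¹) • (d + -d) ^ n := by
    rw [(Commute.refl d).neg_right.add_pow', Finset.smul_sum]
    refine Finset.sum_congr rfl ?_
    rintro ⟨i, j⟩ hp
    rw [HasAntidiagonal.mem_antidiagonal] at hp
    subst hp
    simp only [coeff_expSeries]
    rw [← Nat.cast_smul_eq_nsmul ℂ, smul_smul, smul_mul_smul_comm, Nat.choose_symm_add,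
      Nat.add_choose,
      Nat.cast_div (Nat.factorial_mul_factorial_dvd_factorial_add i j)
        (by exact_mod_cast (Nat.mul_ne_zero i.factorial_ne_zero j.factorial_ne_zero))]
    congr 1
    have h1 : ((i + j).factorial : ℂ) ≠ 0 := by exact_mod_cast Nat.factorial_ne_zero _
    have h2 : (i.factorial : ℂ) ≠ 0 := by exact_mod_cast Nat.factorial_ne_zero _
    have h3 : (j.factorial : ℂ) ≠ 0 := by exact_mod_cast Nat.factorial_ne_zero _
    push_cast
    field_simp
  rw [key, add_neg_cancel]
  rcases n with _ | n <;> simp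

/-- The substitution `x ↦ -x` up to sign: `φ_n ↦ (-1)^n φ_n`. -/
def signTwist : Module.End ℂ (ℕ →₀ V) :=
  Finsupp.lsum ℂ fun k => ((-1 : ℂ) ^ k) • Finsupp.lsingle k

theorem signTwist_single (k : ℕ) (v : V) :
    signTwist (Finsupp.single k v) = Finsupp.single k (((-1 : ℂ) ^ k) • v) := by
  simp [signTwist]

theorem signTwist_apply (φ : ℕ →₀ V) (n : ℕ) : signTwist φ n = ((-1 : ℂ) ^ n) • φ n := by
  induction φ using Finsupp.induction_linear with
  | zero => simp
  | add x y hx hy => simp [hx, hy]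
  | single k v =>
    rw [signTwist_single]
    by_cases h : k = n
    · subst h; simp
    · simp [h]

theorem signTwist_signTwist (φ : ℕ →₀ V) : signTwist (signTwist φ) = φ := by
  ext n
  rw [signTwist_apply, signTwist_apply, smul_smul, ← pow_add, Even.neg_one_pow ⟨n, rfl⟩, one_smul]

theorem signTwist_seriesAct_expSeries (d : Module.End ℂ V) (φ : ℕ →₀ V) :
    signTwist (seriesAct (expSeries d) φ) = seriesAct (expSeries (-d)) (signTwist φ) := by
  induction φ using Finsupp.induction_linear with
  | zero => simp
  | add x y hx hy => simp [hx, hy]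
  | single k v =>
    simp only [signTwist_single, seriesAct_single, map_sum]
    refine Finset.sum_congr rfl ?_
    rintro ⟨i, j⟩ hp
    rw [HasAntidiagonal.mem_antidiagonal] at hp
    subst hp
    simp only [coeff_expSeries, neg_pow d, pow_add, LinearMap.smul_apply, map_smul]
    have : ((-1 : Module.End ℂ V) ^ i * d ^ i) = ((-1 : ℂ) ^ i) • d ^ i := by
      rcases Nat.even_or_odd i with h' | h' <;> simp [h'.neg_one_pow]
    rw [this, LinearMap.smul_apply]
    congr 1
    simp only [smul_smul]
    congr 1
    have h1 : ((-1 : ℂ) ^ i) * (-1) ^ i = 1 := by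
      rw [← pow_add, Even.neg_one_pow ⟨i, rfl⟩]
    linear_combination (-(i.factorial : ℂ)⁻¹ * (-1) ^ j) * h1

/-- The skew flip `φ(x) ↦ Sing (e^{x d} φ(-x))`, with coefficients
`∑_i (-1)^{n+i+1} d^i φ_{n+i} / i!`; half skew symmetry reads `Y_-(a) b = skewFlip (Y_-(b) a)`. -/
def skewFlip (d : Module.End ℂ V) : Module.End ℂ (ℕ →₀ V) :=
  -(seriesAct (expSeries d) * signTwist)

theorem skewFlip_apply (d : Module.End ℂ V) (φ : ℕ →₀ V) (n : ℕ) :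
    skewFlip d φ n = ∑ᶠ i : ℕ, ((-1 : ℂ) ^ (n + i + 1) * ((Nat.factorial i : ℂ))⁻¹) •
      (d ^ i) (φ (n + i)) := by
  rw [skewFlip, LinearMap.neg_apply, Finsupp.neg_apply, Module.End.mul_apply, seriesAct_apply,
    ← finsum_neg_distrib]
  refine finsum_congr fun i => ?_
  rw [coeff_expSeries, signTwist_apply, LinearMap.smul_apply, map_smul, smul_smul, ← neg_smul]
  congr 1
  ring

theorem skewFlip_single_apply (d : Module.End ℂ V) (k n : ℕ) (v : V) :
    skewFlip d (Finsupp.single k v) n =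
      if n ≤ k then ((-1 : ℂ) ^ (k + 1) * (((k - n).factorial : ℂ))⁻¹) • (d ^ (k - n)) v
      else 0 := by
  rw [skewFlip, LinearMap.neg_apply, Finsupp.neg_apply, Module.End.mul_apply, signTwist_single,
    seriesAct_single_apply]
  split_ifs with h
  · rw [coeff_expSeries, LinearMap.smul_apply, map_smul, smul_smul, ← neg_smul]
    congr 1
    ring
  · simp

theorem skewFlip_skewFlip (d : Module.End ℂ V) (φ : ℕ →₀ V) : skewFlip d (skewFlip d φ) = φ := by
  simp only [skewFlip, LinearMap.neg_apply, Module.End.mul_apply, map_neg, neg_neg,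
    signTwist_seriesAct_expSeries, signTwist_signTwist]
  rw [← Module.End.mul_apply, ← seriesAct_mul, expSeries_mul_expSeries_neg, seriesAct_one,
    Module.End.one_apply]

/-- The derivative `d/dx` of polar parts: `φ_n ↦ -n φ_{n-1}`. -/
def ddx : Module.End ℂ (ℕ →₀ V) :=
  Finsupp.lsum ℂ fun k => (-((k : ℂ) + 1)) • Finsupp.lsingle (k + 1)

theorem ddx_single (k : ℕ) (v : V) :
    ddx (Finsupp.single k v) = Finsupp.single (k + 1) ((-((k : ℂ) + 1)) • v) := by
  simp [ddx]

theorem ddx_apply (φ : ℕ →₀ V) (n : ℕ) : ddx φ n = -((n : ℂ) • φ (n - 1)) := by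
  induction φ using Finsupp.induction_linear with
  | zero => simp
  | add x y hx hy => simp only [map_add, Finsupp.add_apply, hx, hy, smul_add, neg_add]
  | single k v =>
    rw [ddx_single]
    rcases n with _ | n
    · simp [Finsupp.single_apply]
    · by_cases h : k = n
      · subst h; simp [-neg_add_rev]
      · simp [h]

/-- The operator `d - d/dx` on polar parts, `d` acting coefficientwise. -/
def subDdx (d : Module.End ℂ V) : Module.End ℂ (ℕ →₀ V) := seriesAct (C d) - ddx

theorem subDdx_apply (d : Module.End ℂ V) (φ : ℕ →₀ V) (n : ℕ) :
    subDdx d φ n = d (φ n) + (n : ℂ) • φ (n - 1) := by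
  simp [subDdx, seriesAct_C_apply, ddx_apply]

theorem commute_C_ddx (d : Module.End ℂ V) : Commute (seriesAct (C d)) ddx := by
  refine LinearMap.ext fun φ => Finsupp.ext fun n => ?_
  simp [seriesAct_C_apply, ddx_apply]

theorem signTwist_ddx (φ : ℕ →₀ V) : signTwist (ddx φ) = -ddx (signTwist φ) := by
  induction φ using Finsupp.induction_linear with
  | zero => simp
  | add x y hx hy => simp only [map_add, hx, hy, neg_add]
  | single k v =>
    simp only [signTwist_single, ddx_single, smul_smul, ← Finsupp.single_neg, ← neg_smul]
    congr 2
    ring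

theorem seriesAct_expSeries_ddx (d : Module.End ℂ V) (φ : ℕ →₀ V) :
    seriesAct (expSeries d) (ddx φ) =
      ddx (seriesAct (expSeries d) φ) - seriesAct (C d) (seriesAct (expSeries d) φ) := by
  induction φ using Finsupp.induction_linear with
  | zero => simp
  | add x y hx hy => simp only [map_add, hx, hy]; abel
  | single k v =>
    ext n
    simp only [ddx_single, seriesAct_single_apply, Finsupp.sub_apply, seriesAct_C_apply, ddx_apply,
      coeff_expSeries, LinearMap.smul_apply, map_smul]
    rcases Nat.lt_trichotomy n (k + 1) with h | rfl | h
    · -- the coefficient `k + 1` splits as `n + (k + 1 - n)`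
      obtain ⟨r, rfl⟩ := Nat.exists_eq_add_of_le (Nat.lt_succ_iff.1 h)
      have e1 : n + r + 1 - n = r + 1 := by omega
      have hf : (r.factorial : ℂ) ≠ 0 := by exact_mod_cast Nat.factorial_ne_zero _
      have hr : ((r : ℂ) + 1) ≠ 0 := by exact_mod_cast Nat.succ_ne_zero r
      rcases n with _ | n
      · simp only [zero_add, Nat.zero_le, if_true, Nat.sub_zero, Nat.cast_zero, zero_smul, neg_zero,
          zero_sub, smul_smul, map_smul, pow_succ' d r, Module.End.mul_apply, ← neg_smul]
        congr 1
        rw [Nat.factorial_succ]; push_cast; field_simp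
      · have e2 : n + 1 + r - n = r + 1 := by omega
        simp only [if_pos h.le, e1, if_pos (Nat.le_add_right (n + 1) r), Nat.add_sub_cancel_left,
          Nat.add_sub_cancel, if_pos (show n ≤ n + 1 + r by omega), e2, smul_smul, map_smul,
          ← Module.End.mul_apply, ← pow_succ', ← neg_smul, ← sub_smul]
        congr 1
        rw [Nat.factorial_succ]; push_cast; field_simp; ring
    · simp [-neg_add_rev]
    · have h1 : ¬ n ≤ k + 1 := by omega
      have h2 : ¬ n ≤ k := by omega
      have h3 : ¬ n - 1 ≤ k := by omega
      simp [h1, h2, h3]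

theorem skewFlip_ddx (d : Module.End ℂ V) (φ : ℕ →₀ V) :
    skewFlip d (ddx φ) = subDdx d (skewFlip d φ) := by
  simp only [skewFlip, subDdx, LinearMap.neg_apply, Module.End.mul_apply, signTwist_ddx, map_neg,
    seriesAct_expSeries_ddx, LinearMap.sub_apply]
  abel

theorem skewFlip_subDdx (d : Module.End ℂ V) (φ : ℕ →₀ V) :
    skewFlip d (subDdx d φ) = ddx (skewFlip d φ) := by
  have h := skewFlip_ddx d (skewFlip d φ)
  rw [skewFlip_skewFlip] at h
  rw [← h, skewFlip_skewFlip]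

theorem skewFlip_ddx_pow (d : Module.End ℂ V) (k : ℕ) (φ : ℕ →₀ V) :
    skewFlip d ((ddx ^ k) φ) = (subDdx d ^ k) (skewFlip d φ) := by
  induction k with
  | zero => simp
  | succ k ih =>
    rw [pow_succ', pow_succ', Module.End.mul_apply, skewFlip_ddx, ih, Module.End.mul_apply]

theorem skewFlip_subDdx_pow (d : Module.End ℂ V) (k : ℕ) (φ : ℕ →₀ V) :
    skewFlip d ((subDdx d ^ k) φ) = (ddx ^ k) (skewFlip d φ) := by
  induction k with
  | zero => simp
  | succ k ih =>
    rw [pow_succ', pow_succ', Module.End.mul_apply, skewFlip_subDdx, ih, Module.End.mul_apply]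

theorem commute_subDdx_ddx (d : Module.End ℂ V) : Commute (subDdx d) ddx :=
  (commute_C_ddx d).sub_left (Commute.refl _)

theorem ddx_pow_apply (k : ℕ) (φ : ℕ →₀ V) (n : ℕ) :
    (ddx ^ k) φ n = ((-1 : ℂ) ^ k * (n.descFactorial k : ℂ)) • φ (n - k) := by
  induction k generalizing n with
  | zero => simp
  | succ k ih =>
    rw [pow_succ', Module.End.mul_apply, ddx_apply, ih, smul_smul, ← neg_smul]
    rcases n with _ | n
    · simp
    · rw [Nat.add_sub_cancel, Nat.succ_descFactorial_succ, show n + 1 - (k + 1) = n - k by omega]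
      congr 1
      push_cast
      ring

theorem C_pow_apply (d : Module.End ℂ V) (k : ℕ) (φ : ℕ →₀ V) (n : ℕ) :
    (seriesAct (C d) ^ k) φ n = (d ^ k) (φ n) := by
  induction k with
  | zero => simp
  | succ k ih =>
    rw [pow_succ', pow_succ', Module.End.mul_apply, seriesAct_C_apply, ih, Module.End.mul_apply]

/-- The binomial expansion of `(d - d/dx)^k`, in coefficients. -/
theorem subDdx_pow_apply (d : Module.End ℂ V) (k : ℕ) (φ : ℕ →₀ V) (n : ℕ) :
    (subDdx d ^ k) φ n = ∑ p ∈ range (k + 1),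
      ((k.choose p * n.descFactorial p : ℕ) : ℂ) • (d ^ (k - p)) (φ (n - p)) := by
  rw [subDdx, sub_eq_neg_add, (commute_C_ddx d).symm.neg_left.add_pow, LinearMap.sum_apply,
    Finsupp.finsetSum_apply]
  refine Finset.sum_congr rfl fun p _ => ?_
  have h1 : ((-ddx : Module.End ℂ (ℕ →₀ V)) ^ p) = ((-1 : ℂ) ^ p) • ddx ^ p := by
    rw [← neg_one_smul ℂ (ddx : Module.End ℂ (ℕ →₀ V)), smul_pow]
  rw [h1, ← nsmul_eq_mul', LinearMap.smul_apply, smul_mul_assoc, ← Nat.cast_smul_eq_nsmul ℂ,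
    Finsupp.smul_apply,
    LinearMap.smul_apply, Finsupp.smul_apply, Module.End.mul_apply, ddx_pow_apply, C_pow_apply,
    smul_smul, smul_smul]
  congr 1
  have h2 : ((-1 : ℂ) ^ p) * (-1) ^ p = 1 := by
    rw [← pow_add, Even.neg_one_pow ⟨p, rfl⟩]
  push_cast
  linear_combination ((k.choose p : ℂ) * n.descFactorial p) * h2

/-- `d/dx` does not commute with the shift: `x^p d/dx = d/dx x^p - p x^{p-1}`. -/
theorem X_pow_ddx (p : ℕ) (φ : ℕ →₀ V) :
    seriesAct (X ^ p) (ddx φ) =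
      ddx (seriesAct (X ^ p) φ) - (p : ℂ) • seriesAct (X ^ (p - 1)) φ := by
  ext n
  simp only [seriesAct_X_pow_apply, ddx_apply, Finsupp.sub_apply, Finsupp.smul_apply]
  rcases p with _ | p
  · simp
  · rcases n with _ | n
    · simp
    · rw [show n + 1 + (p + 1) - 1 = n + 1 + p by omega,
        show n + 1 - 1 + (p + 1) = n + 1 + p by omega,
        Nat.add_sub_cancel]
      rw [← neg_smul, ← neg_smul, ← sub_smul]
      congr 1
      push_cast
      ring

theorem X_pow_subDdx (d : Module.End ℂ V) (p : ℕ) (φ : ℕ →₀ V) :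
    seriesAct (X ^ p) (subDdx d φ) =
      subDdx d (seriesAct (X ^ p) φ) + (p : ℂ) • seriesAct (X ^ (p - 1)) φ := by
  have : seriesAct (X ^ p) (seriesAct (C d) φ) = seriesAct (C d) (seriesAct (X ^ p) φ) := by
    ext n
    simp only [seriesAct_X_pow_apply, seriesAct_C_apply]
  simp only [subDdx, LinearMap.sub_apply, map_sub, X_pow_ddx, this]
  abel

end PolarPart


/-! ### The vertex Lie bracket on `𝒞` -/

namespace OneTruncatedConformalAlgebra

open PolarPart

variable {A B : Type*} [AddCommGroup A] [Module ℂ A] [AddCommGroup B] [Module ℂ B]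

theorem mon_induction {motive : FreeC A B → Prop} (zero : motive 0)
    (add : ∀ p q, motive p → motive q → motive (p + q)) (mon : ∀ k u, motive (mon A B k u))
    (p : FreeC A B) : motive p := by
  induction p using TensorProduct.induction_on with
  | zero => exact zero
  | add x y hx hy => exact add x y hx hy
  | tmul f w =>
    induction f using Polynomial.induction_on' with
    | add f g hf hg => rw [TensorProduct.add_tmul]; exact add _ _ hf hg
    | monomial n r =>
      have : (Polynomial.monomial n r : Polynomial ℂ) ⊗ₜ[ℂ] w =
          OneTruncatedConformalAlgebra.mon A B n (r • w) := by
        rw [OneTruncatedConformalAlgebra.mon, TensorProduct.mk_apply, ← TensorProduct.smul_tmul,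
          ← Polynomial.C_mul_X_pow_eq_monomial, Polynomial.smul_eq_C_mul]
      rw [this]
      exact mon n (r • w)

variable (T : OneTruncatedConformalAlgebra A B)

omit [Module ℂ A] [Module ℂ B] in
theorem eq_inl_add_inr (u : A × B) : u = (u.1, 0) + (0, u.2) := by simp

theorem op1_left (a : A) (w : A × B) : T.op1 (a, 0) w = 0 := by
  rw [eq_inl_add_inr w, map_add, T.op1_AA, T.op1_AB, add_zero]

theorem op1_right (a : A) (w : A × B) : T.op1 w (a, 0) = 0 := by
  rw [eq_inl_add_inr w, map_add, LinearMap.add_apply, T.op1_AA, T.op1_BA, add_zero]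

theorem op1_comm (u v : A × B) : T.op1 u v = T.op1 v u := by
  rw [eq_inl_add_inr u, eq_inl_add_inr v]
  simp only [map_add, LinearMap.add_apply, op1_left, op1_right, zero_add]
  exact T.comm1_BB _ _

theorem op1_snd (u v : A × B) : (T.op1 u v).2 = 0 := by
  rw [eq_inl_add_inr u, eq_inl_add_inr v]
  simp only [map_add, LinearMap.add_apply, op1_left, op1_right, zero_add]
  exact T.op1_BB _ _

theorem op1_eq_inl (u v : A × B) : T.op1 u v = ((T.op1 u v).1, 0) :=
  Prod.ext rfl (T.op1_snd u v)

theorem op0_skew (u v : A × B) :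
    T.op0 u v = -T.op0 v u + (0, T.d (T.op1 v u).1) := by
  rw [eq_inl_add_inr u, eq_inl_add_inr v]
  simp only [map_add, LinearMap.add_apply, op1_left, op1_right, zero_add, T.op0_AA, add_zero]
  rw [T.comm_BB u.2 v.2, T.comm_BA u.2 v.1, T.comm_BA v.2 u.1]
  abel

theorem op0_inr_d (u : A × B) (a : A) :
    T.op0 u (0, T.d a) = (0, T.d (T.op0 u (a, 0)).1) := by
  have h := T.d_comm u.2 a
  rw [eq_inl_add_inr u]
  have h2 : T.op0 (u.1, 0) (0, T.d a) = 0 := by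
    have := T.comm_BA (T.d a) u.1
    rw [T.d_op0] at this
    exact neg_eq_zero.1 this.symm
  simp only [map_add, LinearMap.add_apply, T.op0_AA, zero_add, ← h, h2]

theorem op0_inl_snd (u : A × B) (a : A) : (T.op0 u (a, 0)).2 = 0 := by
  rw [eq_inl_add_inr u]
  simp only [map_add, LinearMap.add_apply, T.op0_AA, zero_add, T.op0_BA]

theorem op0_inl_right (u : A × B) (a : A) : T.op0 u (a, 0) = T.op1 u (0, T.d a) := by
  rw [T.op1_comm, T.d_op1, T.op0_skew, T.op1_left]
  simp

/-- The class of `1 ⊗ u` in `𝒞`. -/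
def gen : (A × B) →ₗ[ℂ] T.QuotC := T.proj ∘ₗ mon A B 0

theorem quotD_proj (p : FreeC A B) : T.quotD (T.proj p) = T.proj (freeD A B p) := rfl

theorem dHat_tmul (k : ℕ) (a : A) :
    T.dHat ((Polynomial.X ^ k : Polynomial ℂ) ⊗ₜ[ℂ] a) =
      mon A B k (0, T.d a) - mon A B (k + 1) (a, 0) := by
  simp [dHat, mon, freeD, pow_succ']

theorem proj_mon_d (k : ℕ) (a : A) :
    T.proj (mon A B (k + 1) (a, 0)) = T.proj (mon A B k (0, T.d a)) := by
  symm
  rw [← sub_eq_zero, ← map_sub, ← dHat_tmul]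
  exact (Submodule.Quotient.mk_eq_zero _).2 ⟨_, rfl⟩

theorem quotD_gen_inl (a : A) : T.quotD (T.gen (a, 0)) = T.gen (0, T.d a) := by
  rw [gen, LinearMap.comp_apply, quotD_proj, freeD_mon, proj_mon_d]
  rfl

theorem proj_mon (k : ℕ) (u : A × B) : T.proj (mon A B k u) = (T.quotD ^ k) (T.gen u) := by
  induction k with
  | zero => rfl
  | succ k ih => rw [pow_succ', Module.End.mul_apply, ← ih, quotD_proj, freeD_mon]

theorem proj_surjective : Function.Surjective T.proj := Submodule.mkQ_surjective _

theorem quotD_induction {motive : T.QuotC → Prop}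
    (add : ∀ p q, motive p → motive q → motive (p + q)) (gen : ∀ u, motive (T.gen u))
    (quotD : ∀ c, motive c → motive (T.quotD c)) (c : T.QuotC) : motive c := by
  obtain ⟨p, rfl⟩ := T.proj_surjective c
  induction p using mon_induction with
  | zero => simpa using gen 0
  | add p q hp hq => rw [map_add]; exact add _ _ hp hq
  | mon k u =>
    rw [proj_mon]
    induction k with
    | zero => exact gen u
    | succ k ih => rw [pow_succ', Module.End.mul_apply]; exact quotD _ ih

/-- The polar part `Y_-(u, x) v = (u_0 v) x^{-1} + (u_1 v) x^{-2}` for `u, v ∈ A ⊕ B`. -/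
def genBracket : (A × B) →ₗ[ℂ] (A × B) →ₗ[ℂ] (ℕ →₀ T.QuotC) :=
  T.op0.compr₂ (Finsupp.lsingle 0 ∘ₗ T.gen) + T.op1.compr₂ (Finsupp.lsingle 1 ∘ₗ T.gen)

theorem genBracket_eq (u v : A × B) : T.genBracket u v =
    Finsupp.single 0 (T.gen (T.op0 u v)) + Finsupp.single 1 (T.gen (T.op1 u v)) := rfl

theorem genBracket_apply (u v : A × B) (n : ℕ) : T.genBracket u v n = T.gen (T.op n u v) := by
  rw [genBracket_eq]
  rcases n with _ | _ | n <;> simp [op]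

theorem genBracket_d_left (a : A) (v : A × B) :
    T.genBracket (0, T.d a) v = ddx (T.genBracket (a, 0) v) := by
  ext n
  rw [ddx_apply, genBracket_apply, genBracket_apply]
  rcases n with _ | _ | _ | n <;> simp [op, T.d_op0, T.d_op1, T.op1_left]

theorem genBracket_d_right (u : A × B) (a : A) :
    T.genBracket u (0, T.d a) = subDdx T.quotD (T.genBracket u (a, 0)) := by
  ext n
  simp only [subDdx_apply, genBracket_apply]
  rcases n with _ | _ | _ | n
  · have h : T.op0 u (a, 0) = ((T.op0 u (a, 0)).1, 0) := Prod.ext rfl (T.op0_inl_snd u a)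
    simp only [op, op0_inr_d]
    rw [h, quotD_gen_inl]
    simp
  · simp [op, T.op1_right, T.op0_inl_right]
  · simp [op, T.op1_right]
  · simp [op]

theorem genBracket_skew (u v : A × B) :
    T.genBracket u v = skewFlip T.quotD (T.genBracket v u) := by
  ext n
  rw [genBracket_apply, genBracket_eq, map_add, Finsupp.add_apply, skewFlip_single_apply,
    skewFlip_single_apply]
  rcases n with _ | _ | n
  · simp only [op, T.op0_skew u v, map_add, map_neg, ← T.quotD_gen_inl, ← op1_eq_inl]
    simp
  · simp [op, T.op1_comm u v]
  · simp [op]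

/-- The extension of `genBracket` to `C(A ⊕ B)`, with values in polar parts over `𝒞`, for which
`D` acts as `d/dx` on the left argument and as `D - d/dx` on the right one. -/
def freeBracket : FreeC A B →ₗ[ℂ] FreeC A B →ₗ[ℂ] (ℕ →₀ T.QuotC) :=
  extendMon fun m => (extendMon fun k =>
    (T.genBracket.compr₂ (ddx ^ m * subDdx T.quotD ^ k)).flip).flip

theorem freeBracket_mon (m k : ℕ) (u v : A × B) :
    T.freeBracket (mon A B m u) (mon A B k v) =
      (ddx ^ m) ((subDdx T.quotD ^ k) (T.genBracket u v)) := by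
  simp [freeBracket, extendMon_mon]

/-- `freeBracket_mon` with the two commuting operators exchanged. -/
theorem freeBracket_mon' (m k : ℕ) (u v : A × B) :
    T.freeBracket (mon A B m u) (mon A B k v) =
      (subDdx T.quotD ^ k) ((ddx ^ m) (T.genBracket u v)) := by
  rw [freeBracket_mon, ← Module.End.mul_apply, ← Module.End.mul_apply,
    ((commute_subDdx_ddx T.quotD).pow_pow k m).eq]

theorem range_dHat_induction {motive : FreeC A B → Prop} (zero : motive 0)
    (add : ∀ p q, motive p → motive q → motive (p + q))
    (mon : ∀ k a, motive (mon A B k (0, T.d a) -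
      OneTruncatedConformalAlgebra.mon A B (k + 1) (a, 0)))
    {p : FreeC A B} (hp : p ∈ LinearMap.range T.dHat) : motive p := by
  obtain ⟨x, rfl⟩ := hp
  induction x using TensorProduct.induction_on with
  | zero => simpa using zero
  | add x y hx hy => rw [map_add]; exact add _ _ hx hy
  | tmul f a =>
    induction f using Polynomial.induction_on' with
    | add f g hf hg => rw [TensorProduct.add_tmul, map_add]; exact add _ _ hf hg
    | monomial n r =>
      rw [← Polynomial.C_mul_X_pow_eq_monomial, ← Polynomial.smul_eq_C_mul,
        TensorProduct.smul_tmul, dHat_tmul]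
      exact mon n (r • a)

theorem freeBracket_eq_zero_left {p : FreeC A B} (hp : p ∈ LinearMap.range T.dHat)
    (q : FreeC A B) : T.freeBracket p q = 0 := by
  refine T.range_dHat_induction (motive := fun p => T.freeBracket p q = 0)
    (by simp) (fun p p' hp hp' => by simp [hp, hp']) (fun m a => ?_) hp
  induction q using mon_induction with
  | zero => simp
  | add p q hp hq => rw [map_add, hp, hq, add_zero]
  | mon k v =>
    rw [map_sub, LinearMap.sub_apply, freeBracket_mon', freeBracket_mon', genBracket_d_left,
      pow_succ, Module.End.mul_apply, sub_self]

theorem freeBracket_eq_zero_right (p : FreeC A B) {q : FreeC A B}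
    (hq : q ∈ LinearMap.range T.dHat) : T.freeBracket p q = 0 := by
  refine T.range_dHat_induction (motive := fun q => T.freeBracket p q = 0)
    (by simp) (fun q q' hq hq' => by simp [hq, hq']) (fun k a => ?_) hq
  induction p using mon_induction with
  | zero => simp
  | add p q hp hq => rw [map_add, LinearMap.add_apply, hp, hq, add_zero]
  | mon m u =>
    rw [map_sub, freeBracket_mon, freeBracket_mon, genBracket_d_right,
      pow_succ, Module.End.mul_apply, sub_self]

/-- The descent of a bilinear map to the quotient in both arguments. -/
def liftQ₂ {V W : Type*} [AddCommGroup V] [Module ℂ V] [AddCommGroup W] [Module ℂ W]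
    (P : Submodule ℂ V) (f : V →ₗ[ℂ] V →ₗ[ℂ] W) (h₁ : ∀ x ∈ P, ∀ y, f x y = 0)
    (h₂ : ∀ x, ∀ y ∈ P, f x y = 0) : (V ⧸ P) →ₗ[ℂ] (V ⧸ P) →ₗ[ℂ] W :=
  (P.liftQ (P.liftQ f fun x hx => LinearMap.ext (h₁ x hx)).flip fun y hy => by
    refine LinearMap.ext fun c => ?_
    obtain ⟨x, rfl⟩ := P.mkQ_surjective c
    exact h₂ x y hy).flip

/-- The vertex Lie bracket `c, c' ↦ Y_-(c, x) c'` on `𝒞`. -/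
def bracket : T.QuotC →ₗ[ℂ] T.QuotC →ₗ[ℂ] (ℕ →₀ T.QuotC) :=
  liftQ₂ (LinearMap.range T.dHat) T.freeBracket (fun _ hp q => T.freeBracket_eq_zero_left hp q)
    (fun p _ hq => T.freeBracket_eq_zero_right p hq)

theorem bracket_proj (p q : FreeC A B) :
    T.bracket (T.proj p) (T.proj q) = T.freeBracket p q := rfl

theorem bracket_gen (u v : A × B) : T.bracket (T.gen u) (T.gen v) = T.genBracket u v := by
  rw [gen, LinearMap.comp_apply, LinearMap.comp_apply, bracket_proj, freeBracket_mon]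
  simp

theorem bracket_quotD_right (c c' : T.QuotC) :
    T.bracket c (T.quotD c') = subDdx T.quotD (T.bracket c c') := by
  obtain ⟨p, rfl⟩ := T.proj_surjective c
  obtain ⟨q, rfl⟩ := T.proj_surjective c'
  rw [quotD_proj, bracket_proj, bracket_proj]
  induction q using mon_induction with
  | zero => simp
  | add q q' hq hq' => simp only [map_add, hq, hq']
  | mon k v =>
    induction p using mon_induction with
    | zero => simp
    | add p p' hp hp' => simp only [map_add, LinearMap.add_apply, hp, hp']
    | mon m u =>
      rw [freeD_mon, freeBracket_mon', freeBracket_mon', pow_succ', Module.End.mul_apply]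

theorem bracket_skew (c c' : T.QuotC) : T.bracket c c' = skewFlip T.quotD (T.bracket c' c) := by
  obtain ⟨p, rfl⟩ := T.proj_surjective c
  obtain ⟨q, rfl⟩ := T.proj_surjective c'
  rw [bracket_proj, bracket_proj]
  induction q using mon_induction with
  | zero => simp
  | add q q' hq hq' => simp only [map_add, LinearMap.add_apply, hq, hq']
  | mon k v =>
    induction p using mon_induction with
    | zero => simp
    | add p p' hp hp' => simp only [map_add, LinearMap.add_apply, hp, hp']
    | mon m u =>
      rw [freeBracket_mon, freeBracket_mon', skewFlip_subDdx_pow, skewFlip_ddx_pow,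
        ← genBracket_skew]

/-! ### Comparison with the products on `C(A ⊕ B)` -/

theorem proj_freeD_pow (i : ℕ) (p : FreeC A B) :
    T.proj ((freeD A B ^ i) p) = (T.quotD ^ i) (T.proj p) := by
  induction i with
  | zero => rfl
  | succ i ih =>
    rw [pow_succ', pow_succ', Module.End.mul_apply, Module.End.mul_apply, ← ih, quotD_proj]

theorem proj_act0 (n k : ℕ) (u v : A × B) :
    T.proj (T.act0 n k u v) = (subDdx T.quotD ^ k) (T.genBracket u v) n := by
  rw [subDdx_pow_apply, act0]
  simp only [LinearMap.sum_apply, map_sum, LinearMap.smul_apply, map_smul, LinearMap.compr₂_apply,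
    genBracket_apply, proj_mon]

theorem subDdx_pow_eq_zero {V : Type*} [AddCommGroup V] [Module ℂ V] (d : Module.End ℂ V)
    (φ : ℕ →₀ V) (N k : ℕ) (h : ∀ n, N ≤ n → φ n = 0) (n : ℕ) (hn : N + k ≤ n) :
    (subDdx d ^ k) φ n = 0 := by
  rw [subDdx_pow_apply]
  refine Finset.sum_eq_zero fun p hp => ?_
  rw [Finset.mem_range] at hp
  rw [h _ (by omega), map_zero, smul_zero]

theorem proj_act (n m k : ℕ) (u v : A × B) :
    T.proj (T.act n m k u v) = (subDdx T.quotD ^ k) ((ddx ^ m) (T.genBracket u v)) n := by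
  rcases m with _ | m
  · simp only [act, proj_act0, pow_zero, Module.End.one_apply]
  · -- the right-hand side is the skew flip of the bracket with the arguments exchanged
    have hflip : (subDdx T.quotD ^ k) ((ddx ^ (m + 1)) (T.genBracket u v)) =
        skewFlip T.quotD ((ddx ^ k) ((subDdx T.quotD ^ (m + 1)) (T.genBracket v u))) := by
      rw [skewFlip_ddx_pow, skewFlip_subDdx_pow, ← genBracket_skew]
    rw [hflip, skewFlip_apply, finsum_eq_sum_of_support_subset (s := Finset.range (m + 1 + k + 2))]
    · simp only [act, LinearMap.sum_apply, map_sum, LinearMap.smul_apply, map_smul,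
        LinearMap.compr₂_apply, LinearMap.flip_apply, proj_freeD_pow, proj_act0]
      refine Finset.sum_congr rfl fun i _ => ?_
      rw [ddx_pow_apply, map_smul, smul_smul]
      congr 1
      rw [show n + i + 1 + k = (n + i + 1) + k by rfl, pow_add _ (n + i + 1)]
      ring
    · intro i hi
      rw [Function.mem_support] at hi
      by_contra hlt
      simp only [Finset.coe_range, Set.mem_Iio, not_lt] at hlt
      refine hi ?_
      rw [ddx_pow_apply, subDdx_pow_eq_zero T.quotD _ 2 _ _ _ (by omega)]
      · simp
      · intro n hn
        obtain ⟨n, rfl⟩ := Nat.exists_eq_add_of_le' hn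
        rw [genBracket_apply]
        simp [op]

theorem bracket_apply (p q : FreeC A B) (n : ℕ) :
    T.bracket (T.proj p) (T.proj q) n = T.proj (T.Y0 n p q) := by
  rw [bracket_proj]
  induction q using mon_induction with
  | zero => simp
  | add q q' hq hq' => simp only [map_add, Finsupp.add_apply, hq, hq']
  | mon k v =>
    induction p using mon_induction with
    | zero => simp
    | add p p' hp hp' => simp only [map_add, LinearMap.add_apply, Finsupp.add_apply, hp, hp']
    | mon m u => rw [Y0_mon, proj_act, freeBracket_mon']

end OneTruncatedConformalAlgebra


/-! ### Derivations on a symmetric algebra -/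

namespace SymmetricAlgebra

variable {V M : Type*} [AddCommGroup V] [Module ℂ V] [AddCommGroup M] [Module ℂ M]
  [Module (SymmetricAlgebra ℂ V) M] [Module (SymmetricAlgebra ℂ V)ᵐᵒᵖ M]
  [IsCentralScalar (SymmetricAlgebra ℂ V) M] [IsScalarTower ℂ (SymmetricAlgebra ℂ V) M]

omit [Module (SymmetricAlgebra ℂ V)ᵐᵒᵖ M] [IsCentralScalar (SymmetricAlgebra ℂ V) M]
  [IsScalarTower ℂ (SymmetricAlgebra ℂ V) M] in
theorem derivation_ext {D₁ D₂ : Derivation ℂ (SymmetricAlgebra ℂ V) M}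
    (h : ∀ v, D₁ (ι ℂ V v) = D₂ (ι ℂ V v)) : D₁ = D₂ := by
  refine Derivation.ext fun s => ?_
  induction s using SymmetricAlgebra.induction with
  | algebraMap r => simp
  | ι v => exact h v
  | mul a b ha hb => rw [Derivation.leibniz, Derivation.leibniz, ha, hb]
  | add a b ha hb => rw [map_add, map_add, ha, hb]

/-- The algebra homomorphism `s ↦ s + ε D s` into the square-zero extension by `M`, where `D` is
the derivation extending `f`. -/
def derivHom (f : V →ₗ[ℂ] M) :
    SymmetricAlgebra ℂ V →ₐ[ℂ] TrivSqZeroExt (SymmetricAlgebra ℂ V) M :=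
  lift ((TrivSqZeroExt.inlAlgHom ℂ (SymmetricAlgebra ℂ V) M).toLinearMap ∘ₗ ι ℂ V +
    (TrivSqZeroExt.inrHom (SymmetricAlgebra ℂ V) M).restrictScalars ℂ ∘ₗ f)

theorem fst_derivHom (f : V →ₗ[ℂ] M) (s : SymmetricAlgebra ℂ V) : (derivHom f s).fst = s := by
  have h : (TrivSqZeroExt.fstHom ℂ (SymmetricAlgebra ℂ V) M).comp (derivHom f) =
      AlgHom.id ℂ _ := by
    apply algHom_ext
    refine LinearMap.ext fun x => ?_
    simp [derivHom]
  exact congrArg (fun f : SymmetricAlgebra ℂ V →ₐ[ℂ] SymmetricAlgebra ℂ V => f s) h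

/-- The derivation of the symmetric algebra that extends a linear map on the generators. -/
def extendDerivation (f : V →ₗ[ℂ] M) : Derivation ℂ (SymmetricAlgebra ℂ V) M :=
  Derivation.mk' ((TrivSqZeroExt.sndHom (SymmetricAlgebra ℂ V) M).restrictScalars ℂ ∘ₗ
      (derivHom f).toLinearMap) (by
    intro a b
    simp [fst_derivHom])

theorem extendDerivation_ι (f : V →ₗ[ℂ] M) (v : V) :
    extendDerivation f (ι ℂ V v) = f v := by
  simp [extendDerivation, derivHom]

/-- `extendDerivation` as a linear map. -/
def extendDerivationₗ : (V →ₗ[ℂ] M) →ₗ[ℂ] Derivation ℂ (SymmetricAlgebra ℂ V) M where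
  toFun := extendDerivation
  map_add' f g := derivation_ext fun v => by simp [extendDerivation_ι]
  map_smul' r f := derivation_ext fun v => by simp [extendDerivation_ι]

theorem extendDerivationₗ_ι (f : V →ₗ[ℂ] M) (v : V) :
    extendDerivationₗ f (ι ℂ V v) = f v := extendDerivation_ι f v

end SymmetricAlgebra

/-! ### Polar parts over a differential algebra -/

namespace PolarPart

open Finset PowerSeries

section Naturality

variable {V W : Type*} [AddCommGroup V] [Module ℂ V] [AddCommGroup W] [Module ℂ W]

theorem mapRange_skewFlip (f : V →ₗ[ℂ] W) (d : Module.End ℂ V) (d' : Module.End ℂ W)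
    (h : ∀ v, d' (f v) = f (d v)) (φ : ℕ →₀ V) :
    Finsupp.mapRange.linearMap f (skewFlip d φ) =
      skewFlip d' (Finsupp.mapRange.linearMap f φ) := by
  have hpow : ∀ (k : ℕ) v, (d' ^ k) (f v) = f ((d ^ k) v) := by
    intro k
    induction k with
    | zero => simp
    | succ k ih =>
      intro v
      rw [pow_succ, pow_succ, Module.End.mul_apply, Module.End.mul_apply, h, ih]
  induction φ using Finsupp.induction_linear with
  | zero => simp
  | add x y hx hy => simp only [map_add, hx, hy]
  | single k v =>
    ext n
    simp only [Finsupp.mapRange.linearMap_apply, Finsupp.mapRange_apply, Finsupp.mapRange_single,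
      skewFlip_single_apply]
    split_ifs <;> simp [hpow]

theorem mapRange_subDdx (f : V →ₗ[ℂ] W) (d : Module.End ℂ V) (d' : Module.End ℂ W)
    (h : ∀ v, d' (f v) = f (d v)) (φ : ℕ →₀ V) :
    Finsupp.mapRange.linearMap f (subDdx d φ) = subDdx d' (Finsupp.mapRange.linearMap f φ) := by
  ext n
  simp [subDdx_apply, h]

end Naturality

variable {S : Type*} [CommRing S] [Algebra ℂ S] (D : Derivation ℂ S S)

/-- Multiplication by the series `e^{xD} s ∈ S[[x]]`, through which `s` acts on polar parts in
the right Leibniz rule. -/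
def expMul (s : S) : (Module.End ℂ S)⟦X⟧ :=
  PowerSeries.mk fun i =>
    LinearMap.mulLeft ℂ (((i.factorial : ℂ)⁻¹) • ((D : Module.End ℂ S) ^ i) s)

theorem coeff_expMul_apply (s t : S) (i : ℕ) :
    coeff i (expMul D s) t = (((i.factorial : ℂ)⁻¹) • ((D : Module.End ℂ S) ^ i) s) * t := by
  rw [expMul, coeff_mk]; rfl

theorem pow_leibniz (n : ℕ) (s t : S) : ((D : Module.End ℂ S) ^ n) (s * t) =
    ∑ p ∈ antidiagonal n, n.choose p.1 •
      (((D : Module.End ℂ S) ^ p.1) s * ((D : Module.End ℂ S) ^ p.2) t) := by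
  induction n with
  | zero => simp
  | succ n ih =>
    rw [pow_succ', Module.End.mul_apply, ih, map_sum,
      Finset.sum_antidiagonal_choose_succ_nsmul
        (fun i j => ((D : Module.End ℂ S) ^ i) s * ((D : Module.End ℂ S) ^ j) t) n,
      ← Finset.sum_add_distrib]
    refine Finset.sum_congr rfl fun p hp => ?_
    rw [HasAntidiagonal.mem_antidiagonal] at hp
    have h1 := D.leibniz (((D : Module.End ℂ S) ^ p.1) s) (((D : Module.End ℂ S) ^ p.2) t)
    rw [map_nsmul, Nat.choose_symm_of_eq_add (hp.symm.trans (add_comm _ _)), ← smul_add]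
    congr 1
    simp only [pow_succ', Module.End.mul_apply]
    refine h1.trans ?_
    simp only [smul_eq_mul, Derivation.coeFn_coe]
    ring

theorem smul_eq_seriesAct (s : S) (φ : ℕ →₀ S) :
    s • φ = seriesAct (C (LinearMap.mulLeft ℂ s)) φ := by
  ext n
  rw [seriesAct_C_apply]
  rfl

/-- The operator form of `e^{xD}(s t) = (e^{xD} s)(e^{xD} t)`. -/
theorem expSeries_mul_C (s : S) :
    expSeries (D : Module.End ℂ S) * C (LinearMap.mulLeft ℂ s) =
      expMul D s * expSeries (D : Module.End ℂ S) := by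
  ext1 n
  refine LinearMap.ext fun t => ?_
  rw [coeff_mul_C, coeff_mul, coeff_expSeries, Module.End.mul_apply, LinearMap.smul_apply,
    LinearMap.mulLeft_apply, pow_leibniz, LinearMap.sum_apply, Finset.smul_sum]
  refine Finset.sum_congr rfl ?_
  rintro ⟨i, j⟩ hp
  rw [HasAntidiagonal.mem_antidiagonal] at hp
  subst hp
  rw [Module.End.mul_apply, coeff_expMul_apply, coeff_expSeries, LinearMap.smul_apply,
    smul_mul_smul_comm, ← Nat.cast_smul_eq_nsmul ℂ, smul_smul]
  congr 1
  rw [Nat.choose_symm_add, Nat.add_choose,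
      Nat.cast_div (Nat.factorial_mul_factorial_dvd_factorial_add i j)
        (by exact_mod_cast (Nat.mul_ne_zero i.factorial_ne_zero j.factorial_ne_zero))]
  have h1 : ((i + j).factorial : ℂ) ≠ 0 := by exact_mod_cast Nat.factorial_ne_zero _
  have h2 : (i.factorial : ℂ) ≠ 0 := by exact_mod_cast Nat.factorial_ne_zero _
  have h3 : (j.factorial : ℂ) ≠ 0 := by exact_mod_cast Nat.factorial_ne_zero _
  push_cast
  field_simp

theorem skewFlip_smul (s : S) (φ : ℕ →₀ S) :
    skewFlip (D : Module.End ℂ S) (s • φ) =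
      seriesAct (expMul D s) (skewFlip (D : Module.End ℂ S) φ) := by
  have h : signTwist (s • φ) = s • signTwist φ := by
    ext n
    simp [signTwist_apply]
  rw [skewFlip, LinearMap.neg_apply, LinearMap.neg_apply, map_neg, Module.End.mul_apply,
    Module.End.mul_apply, h, smul_eq_seriesAct, ← Module.End.mul_apply, ← seriesAct_mul,
    expSeries_mul_C, seriesAct_mul, Module.End.mul_apply]

theorem seriesAct_expMul_smul (s t : S) (φ : ℕ →₀ S) :
    seriesAct (expMul D s) (t • φ) = t • seriesAct (expMul D s) φ := by
  rw [smul_eq_seriesAct, smul_eq_seriesAct, ← Module.End.mul_apply, ← Module.End.mul_apply,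
    ← seriesAct_mul, ← seriesAct_mul]
  congr 2
  ext1 n
  refine LinearMap.ext fun r => ?_
  rw [coeff_mul_C, coeff_C_mul, Module.End.mul_apply, Module.End.mul_apply, coeff_expMul_apply,
    coeff_expMul_apply, LinearMap.mulLeft_apply, LinearMap.mulLeft_apply]
  ring

theorem X_pow_mul_expMul (p : ℕ) (s : S) (φ : ℕ →₀ S) :
    seriesAct (X ^ p) (seriesAct (expMul D s) φ) =
      seriesAct (expMul D s) (seriesAct (X ^ p) φ) := by
  rw [← Module.End.mul_apply, ← Module.End.mul_apply,
    ← seriesAct_mul, ← seriesAct_mul, (PowerSeries.commute_X_pow _ _).eq]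

theorem subDdx_smul (s : S) (φ : ℕ →₀ S) :
    subDdx (D : Module.End ℂ S) (s • φ) = s • subDdx (D : Module.End ℂ S) φ + D s • φ := by
  ext n
  simp [subDdx_apply, mul_add, mul_comm (φ n)]
  ring

theorem ddx_smul (s : S) (φ : ℕ →₀ S) : ddx (s • φ) = s • ddx φ := by
  ext n
  simp [ddx_apply]

end PolarPart


/-! ### The Poisson bracket on a symmetric algebra -/

/-- A bilinear bracket with values in polar parts, sesquilinear on the right and half skew
symmetric: a vertex Lie algebra structure on `(V, d)` up to the half commutator formula. -/
structure PolarBracket (V : Type*) [AddCommGroup V] [Module ℂ V] where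
  /-- The operator `D` of `V`. -/
  d : V →ₗ[ℂ] V
  /-- The bracket `a, b ↦ Y_-(a, x) b`. -/
  br : V →ₗ[ℂ] V →ₗ[ℂ] (ℕ →₀ V)
  br_d : ∀ a b, br a (d b) = PolarPart.subDdx d (br a b)
  skew : ∀ a b, br a b = PolarPart.skewFlip d (br b a)

namespace PolarBracket

open Finset PowerSeries PolarPart SymmetricAlgebra

variable {V : Type*} [AddCommGroup V] [Module ℂ V] (P : PolarBracket V)

/-- The coefficientwise inclusion of polar parts over `V` into those over `S(V)`. -/
abbrev polarι : (ℕ →₀ V) →ₗ[ℂ] (ℕ →₀ SymmetricAlgebra ℂ V) :=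
  Finsupp.mapRange.linearMap (ι ℂ V)

/-- `Y_-(c, x)` for a generator `c ∈ V`, as a derivation of `S(V)` into polar parts. -/
def genDer : V →ₗ[ℂ] Derivation ℂ (SymmetricAlgebra ℂ V) (ℕ →₀ SymmetricAlgebra ℂ V) :=
  extendDerivationₗ ∘ₗ P.br.compr₂ polarι

theorem genDer_ι (c c' : V) : P.genDer c (ι ℂ V c') = polarι (P.br c c') :=
  extendDerivationₗ_ι _ _

/-- The derivation of `S(V)` extending `d`. -/
def D : Derivation ℂ (SymmetricAlgebra ℂ V) (SymmetricAlgebra ℂ V) :=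
  extendDerivation (ι ℂ V ∘ₗ P.d)

/-- The derivation `D` as an endomorphism. -/
abbrev DEnd : Module.End ℂ (SymmetricAlgebra ℂ V) :=
  (P.D : SymmetricAlgebra ℂ V →ₗ[ℂ] SymmetricAlgebra ℂ V)

theorem D_ι (c : V) : P.D (ι ℂ V c) = ι ℂ V (P.d c) := extendDerivation_ι _ _

/-- The bracket `c, s ↦ Y_-(s, x) c`, forced by half skew symmetry. -/
def genFlip : SymmetricAlgebra ℂ V →ₗ[ℂ] V →ₗ[ℂ] (ℕ →₀ SymmetricAlgebra ℂ V) :=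
  LinearMap.mk₂ ℂ (fun s c => skewFlip P.DEnd (P.genDer c s))
    (fun s t c => by simp) (fun r s c => by simp) (fun s c c' => by simp) (fun r s c => by simp)

/-- The Poisson bracket `s, t ↦ Y_-(s, x) t` on `S(V)`, a derivation in `t`. -/
def pois : SymmetricAlgebra ℂ V →ₗ[ℂ]
    Derivation ℂ (SymmetricAlgebra ℂ V) (ℕ →₀ SymmetricAlgebra ℂ V) :=
  extendDerivationₗ ∘ₗ P.genFlip

theorem pois_ι_right (s : SymmetricAlgebra ℂ V) (c : V) :
    P.pois s (ι ℂ V c) = skewFlip P.DEnd (P.genDer c s) :=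
  extendDerivationₗ_ι _ _

theorem pois_ι_left (c : V) : P.pois (ι ℂ V c) = P.genDer c := by
  refine derivation_ext fun c' => ?_
  rw [pois_ι_right, genDer_ι, genDer_ι, ← mapRange_skewFlip (ι ℂ V) P.d P.DEnd P.D_ι, ← P.skew]

theorem pois_ι_ι (c c' : V) : P.pois (ι ℂ V c) (ι ℂ V c') = polarι (P.br c c') := by
  rw [pois_ι_left, genDer_ι]

/-- The right Leibniz rule: `Y_-(st, x) = Sing (e^{xD} s Y_-(t, x) + e^{xD} t Y_-(s, x))`. -/
theorem pois_mul_left (s s' t : SymmetricAlgebra ℂ V) : P.pois (s * s') t =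
    seriesAct (expMul P.D s) (P.pois s' t) + seriesAct (expMul P.D s') (P.pois s t) := by
  induction t using SymmetricAlgebra.induction with
  | algebraMap r => simp
  | ι c =>
    rw [pois_ι_right, pois_ι_right, pois_ι_right, Derivation.leibniz, map_add, skewFlip_smul,
      skewFlip_smul]
  | mul a b ha hb =>
    simp only [Derivation.leibniz, ha, hb, map_add, seriesAct_expMul_smul, smul_add]
    abel
  | add a b ha hb => simp only [map_add, ha, hb]; abel

theorem pois_skew (s t : SymmetricAlgebra ℂ V) :
    P.pois s t = skewFlip P.DEnd (P.pois t s) := by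
  induction s using SymmetricAlgebra.induction with
  | algebraMap r =>
    -- both sides vanish: `Y_-(t)` and, by flipping, `Y_-(·) c` kill constants
    rw [Derivation.map_algebraMap, map_zero]
    induction t using SymmetricAlgebra.induction with
    | algebraMap r => simp
    | ι c => rw [pois_ι_right, Derivation.map_algebraMap, map_zero]
    | mul a b ha hb => rw [Derivation.leibniz, ha, hb, smul_zero, smul_zero, add_zero]
    | add a b ha hb => rw [map_add, ha, hb, add_zero]
  | ι c => rw [pois_ι_right, skewFlip_skewFlip, pois_ι_left]
  | mul a b ha hb =>
    rw [pois_mul_left, ha, hb, Derivation.leibniz, map_add, skewFlip_smul, skewFlip_smul]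
  | add a b ha hb => rw [map_add, Derivation.add_apply, ha, hb, map_add, map_add]

theorem pois_algebraMap_left (r : ℂ) (t : SymmetricAlgebra ℂ V) :
    P.pois (algebraMap ℂ _ r) t = 0 := by
  rw [pois_skew, Derivation.map_algebraMap, map_zero]

theorem genDer_D (c : V) (s : SymmetricAlgebra ℂ V) :
    P.genDer c (P.D s) = subDdx P.DEnd (P.genDer c s) := by
  induction s using SymmetricAlgebra.induction with
  | algebraMap r => simp
  | ι c' => rw [D_ι, genDer_ι, genDer_ι, P.br_d, mapRange_subDdx (ι ℂ V) P.d P.DEnd P.D_ι]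
  | mul a b ha hb =>
    simp only [Derivation.leibniz, map_add, smul_eq_mul, ha, hb, subDdx_smul]
    abel
  | add a b ha hb => simp only [map_add, ha, hb]

theorem pois_D_left (s t : SymmetricAlgebra ℂ V) : P.pois (P.D s) t = ddx (P.pois s t) := by
  induction t using SymmetricAlgebra.induction with
  | algebraMap r => simp
  | ι c => rw [pois_ι_right, pois_ι_right, genDer_D, skewFlip_subDdx]
  | mul a b ha hb => simp only [Derivation.leibniz, map_add, ha, hb, ddx_smul]
  | add a b ha hb => simp only [map_add, ha, hb]

theorem pois_D_right (s t : SymmetricAlgebra ℂ V) :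
    P.pois s (P.D t) = subDdx P.DEnd (P.pois s t) := by
  rw [pois_skew, pois_D_left, skewFlip_ddx, ← pois_skew]

/-- The products `s_n t` on `S(V)`. -/
def prod (n : ℕ) :
    SymmetricAlgebra ℂ V →ₗ[ℂ] SymmetricAlgebra ℂ V →ₗ[ℂ] SymmetricAlgebra ℂ V :=
  LinearMap.mk₂ ℂ (fun s t => P.pois s t n)
    (fun _ _ _ => by simp) (fun _ _ _ => by simp) (fun _ _ _ => by simp) (fun _ _ _ => by simp)

theorem prod_apply (n : ℕ) (s t : SymmetricAlgebra ℂ V) : P.prod n s t = P.pois s t n := rfl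

theorem prod_mul_right (n : ℕ) (a s t : SymmetricAlgebra ℂ V) :
    P.prod n a (s * t) = P.prod n a s * t + s * P.prod n a t := by
  simp only [prod_apply, Derivation.leibniz, Finsupp.add_apply, Finsupp.smul_apply, smul_eq_mul]
  ring

theorem prod_D_right (n : ℕ) (a s : SymmetricAlgebra ℂ V) :
    P.prod n a (P.D s) = P.D (P.prod n a s) + (n : ℂ) • P.prod (n - 1) a s := by
  rw [prod_apply, pois_D_right, subDdx_apply]; rfl

/-- `a_n (e^{xD} b) = ∑_p binom(n,p) x^p e^{xD} (a_{n-p} b)`, in coefficients. -/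
theorem prod_pow_D_right (n i : ℕ) (a b : SymmetricAlgebra ℂ V) :
    P.prod n a (((i.factorial : ℂ)⁻¹) • (P.DEnd ^ i) b) =
      ∑ p ∈ range (i + 1), (n.choose p : ℂ) •
        ((((i - p).factorial : ℂ)⁻¹) • (P.DEnd ^ (i - p)) (P.prod (n - p) a b)) := by
  have h : P.pois a ((P.DEnd ^ i) b) = (subDdx P.DEnd ^ i) (P.pois a b) := by
    induction i with
    | zero => simp
    | succ i ih =>
      rw [pow_succ', pow_succ', Module.End.mul_apply, Module.End.mul_apply, ← ih]
      exact P.pois_D_right _ _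
  rw [map_smul, prod_apply, h, subDdx_pow_apply, Finset.smul_sum]
  refine Finset.sum_congr rfl fun p hp => ?_
  have hpi : p ≤ i := Nat.lt_succ_iff.1 (Finset.mem_range.1 hp)
  rw [smul_smul, smul_smul, ← prod_apply]
  congr 1
  have h1 : (i.factorial : ℂ) ≠ 0 := by exact_mod_cast Nat.factorial_ne_zero _
  have h2 : ((i - p).factorial : ℂ) ≠ 0 := by exact_mod_cast Nat.factorial_ne_zero _
  have h3 : (i.choose p : ℂ) * p.factorial * (i - p).factorial = i.factorial := by
    exact_mod_cast Nat.choose_mul_factorial_mul_factorial hpi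
  rw [Nat.descFactorial_eq_factorial_mul_choose]
  push_cast
  field_simp
  linear_combination (n.choose p : ℂ) * h3

theorem C_mul_expMul (n : ℕ) (a b : SymmetricAlgebra ℂ V) :
    C (P.prod n a) * expMul P.D b = expMul P.D b * C (P.prod n a) +
      ∑ p ∈ range (n + 1), (n.choose p : ℂ) •
        ((X : (Module.End ℂ (SymmetricAlgebra ℂ V))⟦X⟧) ^ p * expMul P.D (P.prod (n - p) a b)) := by
  ext1 i
  refine LinearMap.ext fun t => ?_
  rw [coeff_C_mul, map_add, coeff_mul_C, LinearMap.add_apply, Module.End.mul_apply,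
    Module.End.mul_apply, coeff_expMul_apply, coeff_expMul_apply, prod_mul_right, add_comm,
    prod_pow_D_right, map_sum, LinearMap.sum_apply, Finset.sum_mul]
  congr 1
  -- both sums extend to `p ≤ n + i`: the coefficient vanishes for `p > n`, the power of `D`
  -- for `p > i`
  trans ∑ p ∈ range (n + i + 1), if p ≤ i then ((n.choose p : ℂ) •
        ((((i - p).factorial : ℂ)⁻¹) • (P.DEnd ^ (i - p)) (P.prod (n - p) a b))) * t else 0
  · refine (Finset.sum_congr rfl fun p hp => ?_).trans
      (Finset.sum_subset (s₁ := range (i + 1)) (fun p hp => ?_) fun p _ hp => ?_)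
    · rw [if_pos (Nat.lt_succ_iff.1 (Finset.mem_range.1 hp))]
    · simp only [Finset.mem_range] at *
      omega
    · simp only [Finset.mem_range] at hp
      rw [if_neg (by omega)]
  · symm
    refine (Finset.sum_congr rfl fun p hp => ?_).trans
      (Finset.sum_subset (s₁ := range (n + 1)) (fun p hp => ?_) fun p _ hp => ?_)
    · rw [coeff_smul, LinearMap.smul_apply, coeff_X_pow_mul']
      split_ifs with h
      · rw [coeff_expMul_apply, smul_mul_assoc (n.choose p : ℂ)]
      · simp
    · simp only [Finset.mem_range] at *
      omega
    · simp only [Finset.mem_range] at hp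
      rw [Nat.choose_eq_zero_of_lt (by omega)]
      simp

/-! ### The half commutator formula -/

/-- The defect of the half commutator formula for `a_m` and `Y_-(b, x)`, applied to `c`. -/
def jac (m : ℕ) (a b c : SymmetricAlgebra ℂ V) : ℕ →₀ SymmetricAlgebra ℂ V :=
  seriesAct (C (P.prod m a)) (P.pois b c) - P.pois b (P.prod m a c) -
    ∑ p ∈ range (m + 1), (m.choose p : ℂ) • seriesAct (X ^ p) (P.pois (P.prod (m - p) a b) c)

theorem jac_apply (m n : ℕ) (a b c : SymmetricAlgebra ℂ V) : P.jac m a b c n =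
    P.prod m a (P.prod n b c) - P.prod n b (P.prod m a c) -
      ∑ p ∈ range (m + 1), (m.choose p : ℂ) • P.prod (n + p) (P.prod (m - p) a b) c := by
  simp only [jac, Finsupp.sub_apply, seriesAct_C_apply, Finsupp.finsetSum_apply,
    Finsupp.smul_apply, seriesAct_X_pow_apply, prod_apply]

theorem jac_add_right (m : ℕ) (a b c c' : SymmetricAlgebra ℂ V) :
    P.jac m a b (c + c') = P.jac m a b c + P.jac m a b c' := by
  simp only [jac, map_add, smul_add, Finset.sum_add_distrib]
  abel

theorem jac_add_mid (m : ℕ) (a b b' c : SymmetricAlgebra ℂ V) :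
    P.jac m a (b + b') c = P.jac m a b c + P.jac m a b' c := by
  simp only [jac, map_add, smul_add, Finset.sum_add_distrib, Derivation.add_apply]
  abel

theorem jac_algebraMap_right (m : ℕ) (a b : SymmetricAlgebra ℂ V) (r : ℂ) :
    P.jac m a b (algebraMap ℂ _ r) = 0 := by
  simp [jac, prod_apply]

theorem jac_algebraMap_mid (m : ℕ) (a c : SymmetricAlgebra ℂ V) (r : ℂ) :
    P.jac m a (algebraMap ℂ _ r) c = 0 := by
  simp [jac, prod_apply, pois_algebraMap_left]

theorem seriesAct_C_prod_smul (m : ℕ) (a s : SymmetricAlgebra ℂ V)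
    (φ : ℕ →₀ SymmetricAlgebra ℂ V) :
    seriesAct (C (P.prod m a)) (s • φ) =
      P.prod m a s • φ + s • seriesAct (C (P.prod m a)) φ := by
  ext n
  simp [seriesAct_C_apply, prod_mul_right]

theorem seriesAct_X_pow_smul (p : ℕ) (s : SymmetricAlgebra ℂ V)
    (φ : ℕ →₀ SymmetricAlgebra ℂ V) :
    seriesAct (X ^ p) (s • φ) = s • seriesAct (X ^ p) φ := by
  ext n
  simp [seriesAct_X_pow_apply]

theorem jac_mul_right (m : ℕ) (a b c c' : SymmetricAlgebra ℂ V) :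
    P.jac m a b (c * c') = c • P.jac m a b c' + c' • P.jac m a b c := by
  simp only [jac, Derivation.leibniz, map_add, prod_mul_right, seriesAct_C_prod_smul,
    seriesAct_X_pow_smul, smul_add, Finset.sum_add_distrib, smul_sub, Finset.smul_sum,
    smul_comm c, smul_comm c']
  simp only [smul_comm _ c, smul_comm _ c']
  abel

theorem jac_mul_mid (m : ℕ) (a b b' c : SymmetricAlgebra ℂ V) :
    P.jac m a (b * b') c = seriesAct (expMul P.D b) (P.jac m a b' c) +
      seriesAct (expMul P.D b') (P.jac m a b c) := by
  have key : ∀ b φ, seriesAct (C (P.prod m a)) (seriesAct (expMul P.D b) φ) =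
      seriesAct (expMul P.D b) (seriesAct (C (P.prod m a)) φ) +
        ∑ p ∈ range (m + 1), (m.choose p : ℂ) •
          seriesAct (X ^ p) (seriesAct (expMul P.D (P.prod (m - p) a b)) φ) := by
    intro b φ
    simp only [← Module.End.mul_apply, ← seriesAct_mul, C_mul_expMul, seriesAct_add,
      seriesAct_sum, seriesAct_smul, LinearMap.add_apply, LinearMap.sum_apply,
      LinearMap.smul_apply]
  simp only [jac, pois_mul_left, map_add, map_sub, key, prod_mul_right, Derivation.add_apply,
    map_sum, map_smul, smul_add, Finset.sum_add_distrib, X_pow_mul_expMul]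
  abel

theorem C_prod_subDdx (m : ℕ) (a : SymmetricAlgebra ℂ V) (φ : ℕ →₀ SymmetricAlgebra ℂ V) :
    seriesAct (C (P.prod m a)) (subDdx P.DEnd φ) =
      subDdx P.DEnd (seriesAct (C (P.prod m a)) φ) +
        (m : ℂ) • seriesAct (C (P.prod (m - 1) a)) φ := by
  ext n
  have := P.prod_D_right m a (φ n)
  simp only [seriesAct_C_apply, subDdx_apply, map_add, map_smul, Finsupp.add_apply,
    Finsupp.smul_apply]
  rw [Derivation.coeFn_coe, this]
  abel

theorem C_prod_ddx (m : ℕ) (a : SymmetricAlgebra ℂ V) (φ : ℕ →₀ SymmetricAlgebra ℂ V) :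
    seriesAct (C (P.prod m a)) (ddx φ) = ddx (seriesAct (C (P.prod m a)) φ) := by
  ext n
  simp [seriesAct_C_apply, ddx_apply]

theorem jac_D_right (m : ℕ) (a b c : SymmetricAlgebra ℂ V) :
    P.jac m a b (P.D c) = subDdx P.DEnd (P.jac m a b c) + (m : ℂ) • P.jac (m - 1) a b c := by
  have hsum : ∑ p ∈ range (m + 1), (m.choose p : ℂ) • ((p : ℂ) •
        seriesAct (X ^ (p - 1)) (P.pois (P.prod (m - p) a b) c)) =
      (m : ℂ) • ∑ p ∈ range (m - 1 + 1), ((m - 1).choose p : ℂ) •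
        seriesAct (X ^ p) (P.pois (P.prod (m - 1 - p) a b) c) := by
    rcases m with _ | m
    · simp
    · rw [Finset.sum_range_succ', Finset.smul_sum]
      simp only [Nat.cast_zero, zero_smul, smul_zero, add_zero, Nat.add_sub_cancel]
      refine Finset.sum_congr rfl fun p _ => ?_
      rw [smul_smul, smul_smul, Nat.add_sub_add_right]
      congr 1
      exact_mod_cast (Nat.add_one_mul_choose_eq m p).symm
  simp only [jac, pois_D_right, prod_D_right, C_prod_subDdx, map_add, map_sub, map_sum, map_smul,
    Derivation.map_smul, X_pow_subDdx, smul_add, smul_sub, Finset.sum_add_distrib, hsum]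
  abel

theorem jac_D_mid (m : ℕ) (a b c : SymmetricAlgebra ℂ V) :
    P.jac m a (P.D b) c = ddx (P.jac m a b c) := by
  have hsum : ∑ p ∈ range (m + 1), (m.choose p : ℂ) • ((p : ℂ) •
        seriesAct (X ^ (p - 1)) (P.pois (P.prod (m - p) a b) c)) =
      ∑ p ∈ range (m + 1), (m.choose p : ℂ) • (((m - p : ℕ) : ℂ) •
        seriesAct (X ^ p) (P.pois (P.prod (m - p - 1) a b) c)) := by
    rw [Finset.sum_range_succ', Finset.sum_range_succ]
    simp only [Nat.cast_zero, zero_smul, smul_zero, add_zero, Nat.add_sub_cancel, Nat.sub_self]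
    refine Finset.sum_congr rfl fun p _ => ?_
    rw [smul_smul, smul_smul, Nat.sub_sub]
    congr 1
    exact_mod_cast Nat.choose_succ_right_eq m p
  simp only [jac, pois_D_left, prod_D_right, C_prod_ddx, map_add, map_sub, map_sum, map_smul,
    X_pow_ddx, smul_add, smul_sub, Finset.sum_add_distrib, Derivation.add_apply,
    Derivation.smul_apply, Finset.sum_sub_distrib, hsum]
  abel

/-- Inclusion-exclusion: `i`-subsets of an `(m+n)`-set that avoid a given `n`-subset. -/
theorem sum_neg_one_pow_choose (n m i : ℕ) :
    ∑ j ∈ range (n + 1), (-1 : ℂ) ^ j * (n.choose j : ℂ) *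
      (if j ≤ i then ((m + n - j).choose (i - j) : ℂ) else 0) = (m.choose i : ℂ) := by
  induction n generalizing m i with
  | zero => simp
  | succ n ih =>
    rw [Finset.sum_range_succ']
    simp only [Nat.choose_succ_succ', Nat.cast_add, mul_add, add_mul, Finset.sum_add_distrib]
    have h1 : ∑ j ∈ range (n + 1), (-1 : ℂ) ^ (j + 1) * (n.choose (j + 1) : ℂ) *
        (if j + 1 ≤ i then ((m + (n + 1) - (j + 1)).choose (i - (j + 1)) : ℂ) else 0) +
        ((m + n + 1).choose i : ℂ) = ((m + 1).choose i : ℂ) := by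
      have h := Finset.sum_range_succ (fun j => (-1 : ℂ) ^ j * (n.choose j : ℂ) *
        (if j ≤ i then ((m + 1 + n - j).choose (i - j) : ℂ) else 0)) (n + 1)
      rw [Finset.sum_range_succ', ih, Nat.choose_succ_self] at h
      simp only [Nat.cast_zero, mul_zero, zero_mul, add_zero, pow_zero, Nat.choose_zero_right,
        Nat.cast_one, one_mul, Nat.zero_le, if_true, Nat.sub_zero,
        show m + 1 + n = m + (n + 1) by omega] at h
      exact h
    have h2 : ∑ j ∈ range (n + 1), (-1 : ℂ) ^ (j + 1) * (n.choose j : ℂ) *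
        (if j + 1 ≤ i then ((m + (n + 1) - (j + 1)).choose (i - (j + 1)) : ℂ) else 0) =
        (m.choose i : ℂ) - ((m + 1).choose i : ℂ) := by
      rcases i with _ | i
      · simp
      · rw [Nat.choose_succ_succ]
        push_cast
        rw [← ih m i, sub_add_cancel_right, ← Finset.sum_neg_distrib]
        refine Finset.sum_congr rfl fun j _ => ?_
        have hc : m + (n + 1) - (j + 1) = m + n - j := by omega
        rw [hc]
        ring
    simp only [pow_zero, one_mul, Nat.choose_zero_right, Nat.cast_one, Nat.zero_le, if_true,
      Nat.sub_zero]
    rw [h2, show m + (n + 1) = m + n + 1 from rfl]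
    linear_combination h1

theorem prod_divPow_D_left (r k : ℕ) (x c : SymmetricAlgebra ℂ V) :
    P.prod r (((k.factorial : ℂ)⁻¹) • (P.DEnd ^ k) x) c =
      ((-1 : ℂ) ^ k * (r.choose k : ℂ)) • P.prod (r - k) x c := by
  have h : P.pois ((P.DEnd ^ k) x) c = (ddx ^ k) (P.pois x c) := by
    induction k with
    | zero => simp
    | succ k ih =>
      rw [pow_succ', pow_succ', Module.End.mul_apply, Module.End.mul_apply, ← ih]
      exact P.pois_D_left _ _
  rw [map_smul, LinearMap.smul_apply, prod_apply, h, ddx_pow_apply, smul_smul, ← prod_apply,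
    Nat.descFactorial_eq_factorial_mul_choose]
  congr 1
  have h1 : (k.factorial : ℂ) ≠ 0 := by exact_mod_cast Nat.factorial_ne_zero _
  push_cast
  field_simp

/-- The right-hand side of the half commutator formula changes sign when the two operators are
exchanged and `a_i b` is replaced by `b_j a`. It is linear in the polar part `φ = Y_-(a) b`, so
only `φ = x^{-i-1} y` has to be considered. -/
theorem sum_prod_skewFlip (m n : ℕ) (φ : ℕ →₀ SymmetricAlgebra ℂ V) (c : SymmetricAlgebra ℂ V) :
    ∑ j ∈ range (n + 1), (n.choose j : ℂ) • P.prod (m + n - j) (skewFlip P.DEnd φ j) c =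
      -∑ i ∈ range (m + 1), (m.choose i : ℂ) • P.prod (m + n - i) (φ i) c := by
  induction φ using Finsupp.induction_linear with
  | zero => simp
  | add x y hx hy =>
    simp only [map_add, Finsupp.add_apply, LinearMap.add_apply, smul_add, Finset.sum_add_distrib,
      hx, hy, neg_add]
  | single i x =>
    have hR : ∑ j ∈ range (m + 1), (m.choose j : ℂ) •
        P.prod (m + n - j) (Finsupp.single i x j) c =
        (m.choose i : ℂ) • P.prod (m + n - i) x c := by
      rw [Finset.sum_eq_single i]
      · simp
      · intro j _ hj
        simp [hj.symm]
      · intro hi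
        rw [Nat.choose_eq_zero_of_lt (by simpa using hi)]
        simp
    rw [hR, ← sum_neg_one_pow_choose n m i, Finset.sum_smul, ← Finset.sum_neg_distrib]
    refine Finset.sum_congr rfl fun j hj => ?_
    rw [skewFlip_single_apply]
    split_ifs with h
    · rw [mul_smul, map_smul, LinearMap.smul_apply, prod_divPow_D_left, smul_smul, smul_smul,
        show m + n - j - (i - j) = m + n - i by omega, ← neg_smul]
      congr 1
      obtain ⟨k, rfl⟩ := Nat.exists_eq_add_of_le h
      rw [Nat.add_sub_cancel_left]
      have h2 : ((-1 : ℂ) ^ k) * (-1) ^ k = 1 := by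
        rw [← pow_add, Even.neg_one_pow ⟨k, rfl⟩]
      rw [pow_succ, pow_add]
      linear_combination (-(n.choose j : ℂ) * (-1) ^ j * ((m + n - j).choose k : ℂ)) * h2
    · simp

theorem sum_range_prod_reflect (m n : ℕ) (a b c : SymmetricAlgebra ℂ V) :
    ∑ p ∈ range (m + 1), (m.choose p : ℂ) • P.prod (n + p) (P.prod (m - p) a b) c =
      ∑ i ∈ range (m + 1), (m.choose i : ℂ) • P.prod (m + n - i) (P.prod i a b) c := by
  rw [← Finset.sum_flip]
  refine Finset.sum_congr rfl fun i hi => ?_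
  have : i ≤ m := Nat.lt_succ_iff.1 (Finset.mem_range.1 hi)
  rw [Nat.choose_symm this, Nat.sub_sub_self this, show n + (m - i) = m + n - i by omega]

/-- By half skew symmetry, the half commutator formula is symmetric in its two operators. -/
theorem jac_swap {a b c : SymmetricAlgebra ℂ V} (h : ∀ m, P.jac m a b c = 0) (n : ℕ) :
    P.jac n b a c = 0 := by
  ext m
  have h1 := congrArg (fun φ => φ n) (h m)
  simp only [jac_apply, Finsupp.zero_apply, sum_range_prod_reflect] at h1 ⊢
  have h2 := P.sum_prod_skewFlip m n (P.pois a b) c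
  rw [← pois_skew] at h2
  simp only [← prod_apply] at h2
  rw [add_comm n m, h2, sub_neg_eq_add, ← neg_eq_zero, ← h1]
  abel

end PolarBracket


/-! ### The vertex Poisson algebra structure and its uniqueness -/

namespace PolarBracket

open PolarPart SymmetricAlgebra

variable {V : Type*} [AddCommGroup V] [Module ℂ V] (P : PolarBracket V)

theorem br_d_left (a b : V) : P.br (P.d a) b = ddx (P.br a b) := by
  rw [P.skew, P.br_d, skewFlip_subDdx, ← P.skew]

/-- Once the half commutator formula holds, `S(V)` is a vertex Poisson algebra. -/
theorem isVertexPoissonAlgebra (h : ∀ m a b c, P.jac m a b c = 0) :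
    IsVertexPoissonAlgebra P.D P.prod where
  truncation a b := by
    refine ⟨(P.pois a b).support.sup id + 1, fun n hn => ?_⟩
    by_contra hne
    have := Finset.le_sup (f := id) (Finsupp.mem_support_iff.2 hne)
    simp only [id] at this
    omega
  derivative n a b := by
    rw [prod_apply, prod_apply]
    exact (congrArg (fun φ => φ n) (P.pois_D_left a b)).trans (ddx_apply _ _)
  skew n a b := by
    rw [prod_apply, pois_skew, skewFlip_apply]
    rfl
  commutator m n a b c := by
    have h1 := congrArg (fun φ => φ n) (h m a b c)
    simp only [jac_apply, sum_range_prod_reflect, Finsupp.zero_apply] at h1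
    exact sub_eq_zero.1 h1
  leibniz := P.prod_mul_right

end PolarBracket

/-- Two vertex Poisson algebra structures on a differential symmetric algebra that agree on
generators are equal: the Leibniz rule and half skew symmetry determine all products. -/
theorem IsVertexPoissonAlgebra.eq_of_eq_on_generators {V : Type*} [AddCommGroup V] [Module ℂ V]
    {d : Derivation ℂ (SymmetricAlgebra ℂ V) (SymmetricAlgebra ℂ V)}
    {Y Y' : ℕ → SymmetricAlgebra ℂ V →ₗ[ℂ] SymmetricAlgebra ℂ V →ₗ[ℂ] SymmetricAlgebra ℂ V}
    (hY : IsVertexPoissonAlgebra d Y) (hY' : IsVertexPoissonAlgebra d Y')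
    (h : ∀ n v w, Y n (SymmetricAlgebra.ι ℂ V v) (SymmetricAlgebra.ι ℂ V w) =
      Y' n (SymmetricAlgebra.ι ℂ V v) (SymmetricAlgebra.ι ℂ V w)) : Y = Y' := by
  have ext : ∀ (n : ℕ) (a : SymmetricAlgebra ℂ V),
      (∀ w, Y n a (SymmetricAlgebra.ι ℂ V w) = Y' n a (SymmetricAlgebra.ι ℂ V w)) →
      ∀ b, Y n a b = Y' n a b := by
    intro n a hgen b
    have hD := SymmetricAlgebra.derivation_ext (V := V)
      (D₁ := Derivation.mk' (Y n a) fun b c => by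
        rw [hY.leibniz, smul_eq_mul, smul_eq_mul]; ring)
      (D₂ := Derivation.mk' (Y' n a) fun b c => by
        rw [hY'.leibniz, smul_eq_mul, smul_eq_mul]; ring) hgen
    exact congrArg (fun D : Derivation ℂ (SymmetricAlgebra ℂ V) (SymmetricAlgebra ℂ V) => D b) hD
  funext n
  refine LinearMap.ext fun a => LinearMap.ext fun b => ext n a (fun w => ?_) b
  rw [hY.skew, hY'.skew]
  exact finsum_congr fun i => by rw [ext (n + i) _ (h (n + i) w) a]

namespace OneTruncatedConformalAlgebra

open PolarPart

variable {A B : Type*} [AddCommGroup A] [Module ℂ A] [AddCommGroup B] [Module ℂ B]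
variable (T : OneTruncatedConformalAlgebra A B)

/-- The bracket of `𝒞` as a `PolarBracket`. -/
def polarBracket : PolarBracket T.QuotC where
  d := T.quotD
  br := T.bracket
  br_d := T.bracket_quotD_right
  skew := T.bracket_skew

theorem polarBracket_D : T.polarBracket.D = T.symD :=
  SymmetricAlgebra.derivation_ext fun c => by
    rw [PolarBracket.D_ι, symD_ι]; rfl

/-- The element of `S(𝒞)` given by `u ∈ A ⊕ B`. -/
def symGen : (A × B) →ₗ[ℂ] T.SymC := SymmetricAlgebra.ι ℂ T.QuotC ∘ₗ T.gen

theorem prod_symGen (n : ℕ) (u v : A × B) :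
    T.polarBracket.prod n (T.symGen u) (T.symGen v) = T.symGen (T.op n u v) := by
  simp only [symGen, LinearMap.comp_apply, PolarBracket.prod_apply, PolarBracket.pois_ι_ι]
  rw [Finsupp.mapRange.linearMap_apply, Finsupp.mapRange_apply,
    show T.polarBracket.br = T.bracket from rfl, bracket_gen, genBracket_apply]

/-- The half commutator formula for `A ⊕ B`, a restatement of the associativity axioms. -/
theorem op_commutator (m n : ℕ) (u v w : A × B) :
    T.op m u (T.op n v w) - T.op n v (T.op m u w) =
      ∑ p ∈ Finset.range (m + 1), (m.choose p : ℂ) • T.op (n + p) (T.op (m - p) u v) w := by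
  have h11 : ∀ x y z, T.op1 (T.op1 x y) z = 0 := fun x y z => by rw [T.op1_eq_inl x y, op1_left]
  have h11' : ∀ x y z, T.op1 z (T.op1 x y) = 0 := fun x y z => by rw [T.op1_eq_inl x y, op1_right]
  rcases m with _ | _ | m
  · rcases n with _ | _ | n
    · simp [op, T.assoc0 u v w]
    · simp [op, T.assoc1 u v w]
    · simp [op]
  · rcases n with _ | _ | n
    · have h1 := T.assoc1 v u w
      have h2 : T.op1 (T.op0 u v) w = -T.op1 (T.op0 v u) w + -T.op0 (T.op1 v u) w := by
        rw [T.op0_skew u v, map_add, LinearMap.add_apply, T.d_op1, ← op1_eq_inl, map_neg,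
          LinearMap.neg_apply]
      rw [T.op1_comm v u] at h2
      simp [op, h1, h2, Finset.sum_range_succ]
    · simp [op, h11, h11', Finset.sum_range_succ]
    · simp [op, Finset.sum_range_succ]
  · have hL : T.op (m + 1 + 1) u (T.op n v w) - T.op n v (T.op (m + 1 + 1) u w) = 0 := by
      simp [op]
    rw [hL]
    symm
    refine Finset.sum_eq_zero fun p hp => ?_
    rw [Finset.mem_range] at hp
    rcases Nat.lt_trichotomy p (m + 1) with h | h | h
    · obtain ⟨r, hr⟩ := Nat.exists_eq_add_of_le h
      rw [show m + 1 + 1 - p = r + 2 by omega]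
      simp [op]
    · subst h
      rcases n with _ | n
      · rcases m with _ | m
        · simp [op, h11]
        · rw [show 0 + (m + 1 + 1) = m + 2 by omega]
          simp [op]
      · rw [show n + 1 + (m + 1) = n + m + 2 by omega]
        simp [op]
    · obtain rfl : p = m + 2 := by omega
      rw [show n + (m + 2) = n + m + 2 by omega]
      simp [op]

theorem jac_symGen (m : ℕ) (u v w : A × B) :
    T.polarBracket.jac m (T.symGen u) (T.symGen v) (T.symGen w) = 0 := by
  ext n
  simp only [PolarBracket.jac_apply, prod_symGen, ← map_smul, ← map_sum, ← map_sub,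
    op_commutator, sub_self, Finsupp.zero_apply]

/-- `S(𝒞)` is generated by `A ⊕ B` as a differential algebra. -/
theorem symGen_induction {motive : T.SymC → Prop}
    (algebraMap : ∀ r, motive (algebraMap ℂ _ r)) (symGen : ∀ u, motive (T.symGen u))
    (mul : ∀ a b, motive a → motive b → motive (a * b))
    (add : ∀ a b, motive a → motive b → motive (a + b))
    (D : ∀ a, motive a → motive (T.polarBracket.D a)) (s : T.SymC) : motive s := by
  induction s using SymmetricAlgebra.induction with
  | algebraMap r => exact algebraMap r
  | mul a b ha hb => exact mul a b ha hb
  | add a b ha hb => exact add a b ha hb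
  | ι c =>
    induction c using T.quotD_induction with
    | add p q hp hq => rw [map_add]; exact add _ _ hp hq
    | gen u => exact symGen u
    | quotD c hc =>
      have := D _ hc
      rwa [PolarBracket.D_ι] at this

/-- The half commutator formula extends first in `c`, then in `b`; half skew symmetry exchanges
`a` and `b`, and a second extension in `b` completes the proof. -/
theorem jac_eq_zero (m : ℕ) (a b c : T.SymC) : T.polarBracket.jac m a b c = 0 := by
  have extend_mid : ∀ a : T.SymC, (∀ u m c, T.polarBracket.jac m a (T.symGen u) c = 0) →
      ∀ b m c, T.polarBracket.jac m a b c = 0 := by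
    intro a h b
    induction b using T.symGen_induction with
    | algebraMap r => exact fun m c => PolarBracket.jac_algebraMap_mid _ _ _ _ _
    | symGen u => exact h u
    | mul b b' hb hb' =>
      intro m c
      rw [PolarBracket.jac_mul_mid, hb, hb', map_zero, map_zero, add_zero]
    | add b b' hb hb' => intro m c; rw [PolarBracket.jac_add_mid, hb, hb', add_zero]
    | D b hb => intro m c; rw [PolarBracket.jac_D_mid, hb, map_zero]
  have h1 : ∀ u v c m, T.polarBracket.jac m (T.symGen u) (T.symGen v) c = 0 := by
    intro u v c
    induction c using T.symGen_induction with
    | algebraMap r => exact fun m => PolarBracket.jac_algebraMap_right _ _ _ _ _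
    | symGen w => exact fun m => T.jac_symGen m u v w
    | mul c c' hc hc' =>
      intro m; rw [PolarBracket.jac_mul_right, hc, hc', smul_zero, smul_zero, add_zero]
    | add c c' hc hc' => intro m; rw [PolarBracket.jac_add_right, hc, hc', add_zero]
    | D c hc => intro m; rw [PolarBracket.jac_D_right, hc, hc, map_zero, smul_zero, add_zero]
  have h2 := fun u => extend_mid (T.symGen u) fun v m c => h1 u v c m
  exact extend_mid a (fun u m c => T.polarBracket.jac_swap (fun m => h2 u a m c) m) b m c

theorem isVertexPoissonAlgebra_prod : IsVertexPoissonAlgebra T.symD T.polarBracket.prod := by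
  have h := T.polarBracket.isVertexPoissonAlgebra T.jac_eq_zero
  rwa [polarBracket_D] at h

theorem extendsY0_prod : T.ExtendsY0 T.polarBracket.prod := by
  intro n p q
  rw [PolarBracket.prod_apply, PolarBracket.pois_ι_ι, Finsupp.mapRange.linearMap_apply,
    Finsupp.mapRange_apply, ← bracket_apply]
  rfl

end OneTruncatedConformalAlgebra


/-! ### The grading -/

namespace PolarPart

variable {V : Type*} [AddCommGroup V] [Module ℂ V]

/-- Polar parts of total degree `e` over a graded space: `φ_m` has degree `e - m - 1`. With
`deg x = -1`, this is the homogeneous subspace of degree `e`. -/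
def polarGrade (G : ℕ → Submodule ℂ V) (e : ℕ) : Submodule ℂ (ℕ →₀ V) where
  carrier := {φ | ∀ m, (∀ k, e = k + m + 1 → φ m ∈ G k) ∧ (e < m + 1 → φ m = 0)}
  zero_mem' m := ⟨fun _ _ => zero_mem _, fun _ => rfl⟩
  add_mem' {φ ψ} hφ hψ m := ⟨fun k hk => add_mem ((hφ m).1 k hk) ((hψ m).1 k hk), fun h => by
    rw [Finsupp.add_apply, (hφ m).2 h, (hψ m).2 h, add_zero]⟩
  smul_mem' r φ hφ m := ⟨fun k hk => Submodule.smul_mem _ r ((hφ m).1 k hk), fun h => by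
    rw [Finsupp.smul_apply, (hφ m).2 h, smul_zero]⟩

variable {G : ℕ → Submodule ℂ V}

theorem skewFlip_mem_polarGrade {d : Module.End ℂ V} (hd : ∀ n, ∀ v ∈ G n, d v ∈ G (n + 1))
    {e : ℕ} {φ : ℕ →₀ V} (hφ : φ ∈ polarGrade G e) : skewFlip d φ ∈ polarGrade G e := by
  have hpow : ∀ i n, ∀ v ∈ G n, (d ^ i) v ∈ G (n + i) := by
    intro i
    induction i with
    | zero => intro n v hv; exact hv
    | succ i ih => intro n v hv; rw [pow_succ', Module.End.mul_apply]; exact hd _ _ (ih n v hv)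
  intro m
  rw [skewFlip_apply]
  constructor
  · intro k hk
    refine finsum_induction (fun v => v ∈ G k) (zero_mem _) (fun _ _ => add_mem) fun i => ?_
    refine Submodule.smul_mem _ _ ?_
    by_cases hik : i ≤ k
    · have := hpow i (k - i) _ ((hφ (m + i)).1 (k - i) (by omega))
      rwa [Nat.sub_add_cancel hik] at this
    · rw [(hφ (m + i)).2 (by omega), map_zero]
      exact zero_mem _
  · intro h
    refine finsum_eq_zero_of_forall_eq_zero fun i => ?_
    rw [(hφ (m + i)).2 (by omega), map_zero, smul_zero]

theorem ddx_mem_polarGrade {e : ℕ} {φ : ℕ →₀ V} (hφ : φ ∈ polarGrade G e) :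
    ddx φ ∈ polarGrade G (e + 1) := by
  intro m
  rw [ddx_apply]
  rcases m with _ | m
  · simp
  · exact ⟨fun k hk => neg_mem (Submodule.smul_mem _ _ ((hφ m).1 k (by omega))), fun h => by
      rw [Nat.add_sub_cancel, (hφ m).2 (by omega), smul_zero, neg_zero]⟩

theorem subDdx_mem_polarGrade {d : Module.End ℂ V} (hd : ∀ n, ∀ v ∈ G n, d v ∈ G (n + 1))
    {e : ℕ} {φ : ℕ →₀ V} (hφ : φ ∈ polarGrade G e) : subDdx d φ ∈ polarGrade G (e + 1) := by
  refine sub_mem (fun m => ?_) (ddx_mem_polarGrade hφ)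
  rw [seriesAct_C_apply]
  refine ⟨fun k hk => ?_, fun h => by rw [(hφ m).2 (by omega), map_zero]⟩
  rcases k with _ | k
  · rw [(hφ m).2 (by omega), map_zero]
    exact zero_mem _
  · exact hd _ _ ((hφ m).1 k (by omega))

theorem smul_mem_polarGrade {S : Type*} [CommRing S] [Algebra ℂ S] {𝒮 : ℕ → Submodule ℂ S}
    (hmul : ∀ r s a b, a ∈ 𝒮 r → b ∈ 𝒮 s → a * b ∈ 𝒮 (r + s)) {r e : ℕ} {s : S} (hs : s ∈ 𝒮 r)
    {φ : ℕ →₀ S} (hφ : φ ∈ polarGrade 𝒮 e) : s • φ ∈ polarGrade 𝒮 (e + r) := by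
  intro m
  rw [Finsupp.smul_apply, smul_eq_mul]
  refine ⟨fun k hk => ?_, fun h => by rw [(hφ m).2 (by omega), mul_zero]⟩
  by_cases h : r ≤ k
  · have := hmul r (k - r) _ _ hs ((hφ m).1 (k - r) (by omega))
    rwa [Nat.add_sub_cancel' h] at this
  · rw [(hφ m).2 (by omega), mul_zero]
    exact zero_mem _

end PolarPart

namespace OneTruncatedConformalAlgebra

open PolarPart

variable {A B : Type*} [AddCommGroup A] [Module ℂ A] [AddCommGroup B] [Module ℂ B]
variable (T : OneTruncatedConformalAlgebra A B)

theorem mem_quotGrade_zero {c : T.QuotC} : c ∈ T.quotGrade 0 ↔ ∃ a : A, c = T.gen (a, 0) := by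
  constructor
  · rintro ⟨_, ⟨a, rfl⟩, rfl⟩
    exact ⟨a, rfl⟩
  · rintro ⟨a, rfl⟩
    exact ⟨_, ⟨a, rfl⟩, rfl⟩

/-- In positive degrees `A` contributes nothing new, since `D^{n+1} a = D^n ∂a` in `𝒞`. -/
theorem mem_quotGrade_succ {n : ℕ} {c : T.QuotC} :
    c ∈ T.quotGrade (n + 1) ↔ ∃ b : B, c = T.proj (mon A B n (0, b)) := by
  constructor
  · rintro ⟨p, hp, rfl⟩
    obtain ⟨_, ⟨a, rfl⟩, _, ⟨b, rfl⟩, rfl⟩ := Submodule.mem_sup.1 hp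
    refine ⟨T.d a + b, ?_⟩
    have h : ((0, T.d a + b) : A × B) = (0, T.d a) + (0, b) := by simp
    rw [h, map_add, map_add, map_add, ← proj_mon_d]
    rfl
  · rintro ⟨b, rfl⟩
    exact ⟨_, Submodule.mem_sup_right ⟨b, rfl⟩, rfl⟩

theorem quotD_mem_quotGrade (n : ℕ) (c : T.QuotC) (hc : c ∈ T.quotGrade n) :
    T.quotD c ∈ T.quotGrade (n + 1) := by
  rcases n with _ | n
  · obtain ⟨a, rfl⟩ := T.mem_quotGrade_zero.1 hc
    exact T.mem_quotGrade_succ.2 ⟨T.d a, T.quotD_gen_inl a⟩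
  · obtain ⟨b, rfl⟩ := T.mem_quotGrade_succ.1 hc
    exact T.mem_quotGrade_succ.2 ⟨b, by rw [quotD_proj, freeD_mon]⟩

theorem quotGrade_induction {motive : ℕ → T.QuotC → Prop} (inl : ∀ a : A, motive 0 (T.gen (a, 0)))
    (inr : ∀ b : B, motive 1 (T.gen (0, b)))
    (quotD : ∀ n c, motive n c → motive (n + 1) (T.quotD c)) {n : ℕ} {c : T.QuotC}
    (hc : c ∈ T.quotGrade n) : motive n c := by
  rcases n with _ | n
  · obtain ⟨a, rfl⟩ := T.mem_quotGrade_zero.1 hc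
    exact inl a
  · obtain ⟨b, rfl⟩ := T.mem_quotGrade_succ.1 hc
    clear hc
    induction n with
    | zero => exact inr b
    | succ n ih => rw [← freeD_mon, ← quotD_proj]; exact quotD _ _ ih

theorem gen_inl_mem (a : A) : T.gen (a, 0) ∈ T.quotGrade 0 := T.mem_quotGrade_zero.2 ⟨a, rfl⟩

theorem gen_inr_mem (b : B) : T.gen (0, b) ∈ T.quotGrade 1 := T.mem_quotGrade_succ.2 ⟨b, rfl⟩

theorem bracket_mem_polarGrade {n r : ℕ} {c c' : T.QuotC} (hc : c ∈ T.quotGrade n)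
    (hc' : c' ∈ T.quotGrade r) : T.bracket c c' ∈ polarGrade T.quotGrade (n + r) := by
  -- raising the right argument by `D`
  have right : ∀ m u, (∀ a : A, T.genBracket u (a, 0) ∈ polarGrade T.quotGrade m) →
      (∀ b : B, T.genBracket u (0, b) ∈ polarGrade T.quotGrade (m + 1)) →
      T.bracket (T.gen u) c' ∈ polarGrade T.quotGrade (m + r) := by
    intro m u hA hB
    refine T.quotGrade_induction
      (motive := fun r c' => T.bracket (T.gen u) c' ∈ polarGrade T.quotGrade (m + r)) ?_ ?_ ?_ hc'
    · intro a; rw [bracket_gen]; exact hA a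
    · intro b; rw [bracket_gen]; exact hB b
    · intro k c' h
      rw [bracket_quotD_right]
      exact subDdx_mem_polarGrade T.quotD_mem_quotGrade h
  refine T.quotGrade_induction
    (motive := fun n c => T.bracket c c' ∈ polarGrade T.quotGrade (n + r)) ?_ ?_ ?_ hc
  · intro a
    refine right 0 _ (fun a' => ?_) fun b m => ?_
    · rw [genBracket_eq, T.op0_AA, T.op1_AA]
      simp
    · rw [genBracket_apply]
      rcases m with _ | _ | m
      · refine ⟨fun k hk => ?_, fun h => by omega⟩
        obtain rfl : k = 0 := by omega
        exact T.mem_quotGrade_zero.2 ⟨(T.op0 (a, 0) (0, b)).1, congrArg T.gen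
          (Prod.ext rfl (T.op0_AB a b))⟩
      · exact ⟨fun k hk => by omega, fun _ => by simp [op, op1_left]⟩
      · exact ⟨fun k hk => by omega, fun _ => by simp [op]⟩
  · intro b
    refine right 1 _ (fun a m => ?_) fun b' m => ?_
    · rw [genBracket_apply]
      rcases m with _ | _ | m
      · refine ⟨fun k hk => ?_, fun h => by omega⟩
        obtain rfl : k = 0 := by omega
        exact T.mem_quotGrade_zero.2 ⟨(T.op0 (0, b) (a, 0)).1, congrArg T.gen
          (Prod.ext rfl (T.op0_BA b a))⟩
      · exact ⟨fun k hk => by omega, fun _ => by simp [op, op1_right]⟩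
      · exact ⟨fun k hk => by omega, fun _ => by simp [op]⟩
    · rw [genBracket_apply]
      rcases m with _ | _ | m
      · refine ⟨fun k hk => ?_, fun h => by omega⟩
        obtain rfl : k = 1 := by omega
        have h : T.op 0 (0, b) (0, b') = (0, (T.op0 (0, b) (0, b')).2) :=
          Prod.ext (T.op0_BB b b') rfl
        rw [h]
        exact T.gen_inr_mem _
      · refine ⟨fun k hk => ?_, fun h => by omega⟩
        obtain rfl : k = 0 := by omega
        exact T.mem_quotGrade_zero.2 ⟨_, congrArg T.gen (T.op1_eq_inl (0, b) (0, b'))⟩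
      · exact ⟨fun k hk => by omega, fun _ => by simp [op]⟩
  · intro n c h
    have h' := T.polarBracket.br_d_left c c'
    rw [show n + 1 + r = n + r + 1 by omega]
    exact h' ▸ ddx_mem_polarGrade h

/-! ### The grading of `S(𝒞)` -/

theorem one_mem_symGrade : (1 : T.SymC) ∈ T.symGrade 0 :=
  Submodule.subset_span ⟨0, Fin.elim0, Fin.elim0, fun i => i.elim0, by simp, by simp⟩

theorem ι_mul_mem_symGrade {e r : ℕ} {c : T.QuotC} (hc : c ∈ T.quotGrade e) {x : T.SymC}
    (hx : x ∈ T.symGrade r) : SymmetricAlgebra.ι ℂ T.QuotC c * x ∈ T.symGrade (e + r) := by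
  induction hx using Submodule.span_induction with
  | mem x hx =>
    obtain ⟨k, f, g, hg, hf, rfl⟩ := hx
    refine Submodule.subset_span ⟨k + 1, Fin.cons e f, Fin.cons c g, ?_, ?_, ?_⟩
    · intro i
      refine Fin.cases ?_ (fun i => ?_) i
      · simpa using hc
      · simpa using hg i
    · simp [Fin.sum_univ_succ, hf]
    · simp [Fin.prod_univ_succ]
  | zero => rw [mul_zero]; exact zero_mem _
  | add x y _ _ hx hy => rw [mul_add]; exact add_mem hx hy
  | smul r x _ hx => rw [mul_smul_comm]; exact Submodule.smul_mem _ _ hx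

/-- Homogeneous elements are built from `1` by multiplying with homogeneous generators. -/
theorem symGrade_induction {motive : ℕ → T.SymC → Prop} (one : motive 0 1)
    (ι_mul : ∀ e r, ∀ c ∈ T.quotGrade e, ∀ x ∈ T.symGrade r, motive r x →
      motive (e + r) (SymmetricAlgebra.ι ℂ T.QuotC c * x))
    (zero : ∀ n, motive n 0) (add : ∀ n x y, motive n x → motive n y → motive n (x + y))
    (smul : ∀ n (r : ℂ) x, motive n x → motive n (r • x))
    {n : ℕ} {s : T.SymC} (hs : s ∈ T.symGrade n) : motive n s := by
  induction hs using Submodule.span_induction with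
  | zero => exact zero n
  | add x y _ _ hx hy => exact add n x y hx hy
  | smul r x _ hx => exact smul n r x hx
  | mem x hx =>
    obtain ⟨k, e, c, hc, rfl, rfl⟩ := hx
    suffices h : ∏ i, SymmetricAlgebra.ι ℂ T.QuotC (c i) ∈ T.symGrade (∑ i, e i) ∧
        motive (∑ i, e i) (∏ i, SymmetricAlgebra.ι ℂ T.QuotC (c i)) from h.2
    induction k with
    | zero => simpa using ⟨T.one_mem_symGrade, one⟩
    | succ k ih =>
      rw [Fin.sum_univ_succ, Fin.prod_univ_succ]
      obtain ⟨h1, h2⟩ := ih (fun i => e i.succ) (fun i => c i.succ) fun i => hc i.succ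
      exact ⟨T.ι_mul_mem_symGrade (hc 0) h1, ι_mul _ _ _ (hc 0) _ h1 h2⟩

theorem symGrade_le (P : ℕ → Submodule ℂ T.SymC) (one : (1 : T.SymC) ∈ P 0)
    (ι_mul : ∀ e r, ∀ c ∈ T.quotGrade e, ∀ x ∈ P r,
      SymmetricAlgebra.ι ℂ T.QuotC c * x ∈ P (e + r)) (n : ℕ) : T.symGrade n ≤ P n :=
  fun _ hs => T.symGrade_induction (motive := fun n s => s ∈ P n) one
    (fun e r c hc x _ hx => ι_mul e r c hc x hx) (fun _ => zero_mem _)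
    (fun _ _ _ => add_mem) (fun _ r _ => Submodule.smul_mem _ r) hs

theorem ι_mem_symGrade {e : ℕ} {c : T.QuotC} (hc : c ∈ T.quotGrade e) :
    SymmetricAlgebra.ι ℂ T.QuotC c ∈ T.symGrade e := by
  simpa using T.ι_mul_mem_symGrade hc T.one_mem_symGrade

theorem mul_mem_symGrade (r s : ℕ) (a b : T.SymC) (ha : a ∈ T.symGrade r)
    (hb : b ∈ T.symGrade s) : a * b ∈ T.symGrade (r + s) := by
  refine T.symGrade_induction (motive := fun r a => a * b ∈ T.symGrade (r + s)) ?_ ?_ ?_ ?_ ?_ ha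
  · simpa using hb
  · intro e r c hc x _ hx
    rw [mul_assoc, add_assoc]
    exact T.ι_mul_mem_symGrade hc hx
  · intro n; rw [zero_mul]; exact zero_mem _
  · intro n x y hx hy; rw [add_mul]; exact add_mem hx hy
  · intro n r x hx; rw [smul_mul_assoc]; exact Submodule.smul_mem _ _ hx

theorem prod_mem_symGrade {ι : Type*} (s : Finset ι) (f : ι → T.SymC) (e : ι → ℕ)
    (h : ∀ i ∈ s, f i ∈ T.symGrade (e i)) : ∏ i ∈ s, f i ∈ T.symGrade (∑ i ∈ s, e i) := by
  classical
  induction s using Finset.induction_on with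
  | empty => simpa using T.one_mem_symGrade
  | insert i s hi ih =>
    rw [Finset.prod_insert hi, Finset.sum_insert hi]
    exact T.mul_mem_symGrade _ _ _ _ (h i (Finset.mem_insert_self _ _))
      (ih fun j hj => h j (Finset.mem_insert_of_mem hj))

theorem symD_mem_symGrade (r : ℕ) (a : T.SymC) (ha : a ∈ T.symGrade r) :
    T.symD a ∈ T.symGrade (r + 1) := by
  refine T.symGrade_induction (motive := fun r a => T.symD a ∈ T.symGrade (r + 1))
    ?_ ?_ ?_ ?_ ?_ ha
  · rw [Derivation.map_one_eq_zero]; exact zero_mem _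
  · intro e r c hc x hx hDx
    rw [Derivation.leibniz, smul_eq_mul, smul_eq_mul, symD_ι, mul_comm x]
    have h1 := T.ι_mul_mem_symGrade hc hDx
    rw [← add_assoc] at h1
    refine add_mem h1 ?_
    have := T.ι_mul_mem_symGrade (T.quotD_mem_quotGrade _ _ hc) hx
    rwa [add_right_comm] at this
  · intro n; rw [map_zero]; exact zero_mem _
  · intro n x y hx hy; rw [map_add]; exact add_mem hx hy
  · intro n r x hx; rw [Derivation.map_smul]; exact Submodule.smul_mem _ _ hx

/-- A derivation of `S(𝒞)` into polar parts is homogeneous once it is so on generators. -/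
theorem derivation_mem_polarGrade (n : ℕ) (Θ : Derivation ℂ T.SymC (ℕ →₀ T.SymC))
    (h : ∀ r, ∀ c ∈ T.quotGrade r,
      Θ (SymmetricAlgebra.ι ℂ T.QuotC c) ∈ polarGrade T.symGrade (n + r))
    {r : ℕ} {s : T.SymC} (hs : s ∈ T.symGrade r) : Θ s ∈ polarGrade T.symGrade (n + r) := by
  refine T.symGrade_induction (motive := fun r s => Θ s ∈ polarGrade T.symGrade (n + r))
    ?_ ?_ ?_ ?_ ?_ hs
  · rw [Derivation.map_one_eq_zero]; exact zero_mem _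
  · intro e r c hc x hx hΘ
    rw [Derivation.leibniz]
    refine add_mem ?_ ?_
    · have := smul_mem_polarGrade T.mul_mem_symGrade (T.ι_mem_symGrade hc) hΘ
      rwa [add_assoc, add_comm r e] at this
    · have := smul_mem_polarGrade T.mul_mem_symGrade hx (h e c hc)
      rwa [add_assoc] at this
  · intro n; rw [map_zero]; exact zero_mem _
  · intro n x y hx hy; rw [map_add]; exact add_mem hx hy
  · intro n r x hx; rw [Derivation.map_smul]; exact Submodule.smul_mem _ _ hx

theorem pois_mem_polarGrade {n r : ℕ} {a b : T.SymC} (ha : a ∈ T.symGrade n)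
    (hb : b ∈ T.symGrade r) : T.polarBracket.pois a b ∈ polarGrade T.symGrade (n + r) := by
  have hgen : ∀ {k l : ℕ} {c : T.QuotC} {s : T.SymC}, c ∈ T.quotGrade k → s ∈ T.symGrade l →
      T.polarBracket.genDer c s ∈ polarGrade T.symGrade (k + l) := by
    intro k l c s hc hs
    refine T.derivation_mem_polarGrade k _ (fun r c' hc' m => ?_) hs
    have h := T.bracket_mem_polarGrade hc hc' m
    rw [PolarBracket.genDer_ι, Finsupp.mapRange.linearMap_apply, Finsupp.mapRange_apply]
    refine ⟨fun j hj => T.ι_mem_symGrade (h.1 j hj), fun hlt => ?_⟩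
    rw [show T.polarBracket.br = T.bracket from rfl, h.2 hlt, map_zero]
  refine T.derivation_mem_polarGrade n _ (fun r c hc => ?_) hb
  rw [PolarBracket.pois_ι_right, add_comm n r]
  refine skewFlip_mem_polarGrade (fun k v hv => ?_) (hgen hc ha)
  rw [Derivation.coeFn_coe, polarBracket_D]
  exact T.symD_mem_symGrade k v hv

/-- The coaction `c ↦ c t^n` for `c ∈ 𝒞_(n)`, on `C(A ⊕ B)`. -/
def freeCoaction : FreeC A B →ₗ[ℂ] Polynomial T.SymC :=
  extendMon fun k =>
    ((Polynomial.monomial k).restrictScalars ℂ ∘ₗ SymmetricAlgebra.ι ℂ T.QuotC ∘ₗ T.proj ∘ₗ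
      mon A B k ∘ₗ LinearMap.inl ℂ A B ∘ₗ LinearMap.fst ℂ A B) +
    ((Polynomial.monomial (k + 1)).restrictScalars ℂ ∘ₗ SymmetricAlgebra.ι ℂ T.QuotC ∘ₗ T.proj ∘ₗ
      mon A B k ∘ₗ LinearMap.inr ℂ A B ∘ₗ LinearMap.snd ℂ A B)

theorem freeCoaction_mon (k : ℕ) (u : A × B) : T.freeCoaction (mon A B k u) =
    Polynomial.monomial k (SymmetricAlgebra.ι ℂ T.QuotC (T.proj (mon A B k (u.1, 0)))) +
    Polynomial.monomial (k + 1)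
      (SymmetricAlgebra.ι ℂ T.QuotC (T.proj (mon A B k (0, u.2)))) := by
  simp [freeCoaction, extendMon_mon]

theorem freeCoaction_eq_zero {p : FreeC A B} (hp : p ∈ LinearMap.range T.dHat) :
    T.freeCoaction p = 0 := by
  refine T.range_dHat_induction (motive := fun p => T.freeCoaction p = 0)
    (by simp) (fun p p' hp hp' => by simp [hp, hp']) (fun m a => ?_) hp
  rw [map_sub, freeCoaction_mon, freeCoaction_mon, ← T.proj_mon_d]
  have h : ((0, 0) : A × B) = 0 := rfl
  simp [h]

/-- The coaction `s ↦ s t^n` for `s ∈ S(𝒞)_(n)`, an algebra homomorphism into `S(𝒞)[t]` whose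
coefficients are the projections to the homogeneous components. -/
def coaction : T.SymC →ₐ[ℂ] Polynomial T.SymC :=
  SymmetricAlgebra.lift ((LinearMap.range T.dHat).liftQ T.freeCoaction
    fun _ hp => T.freeCoaction_eq_zero hp)

theorem coaction_ι_proj (p : FreeC A B) :
    T.coaction (SymmetricAlgebra.ι ℂ T.QuotC (T.proj p)) = T.freeCoaction p := by
  rw [coaction, SymmetricAlgebra.lift_ι_apply]
  rfl

theorem coaction_ι {n : ℕ} {c : T.QuotC} (hc : c ∈ T.quotGrade n) :
    T.coaction (SymmetricAlgebra.ι ℂ T.QuotC c) =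
      Polynomial.monomial n (SymmetricAlgebra.ι ℂ T.QuotC c) := by
  have h : ((0, 0) : A × B) = 0 := rfl
  rcases n with _ | n
  · obtain ⟨a, rfl⟩ := T.mem_quotGrade_zero.1 hc
    rw [gen, LinearMap.comp_apply, coaction_ι_proj, freeCoaction_mon]
    simp [h]
  · obtain ⟨b, rfl⟩ := T.mem_quotGrade_succ.1 hc
    rw [coaction_ι_proj, freeCoaction_mon]
    simp [h]

theorem coaction_of_mem {n : ℕ} {s : T.SymC} (hs : s ∈ T.symGrade n) :
    T.coaction s = Polynomial.monomial n s := by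
  have h := T.symGrade_le
    (fun n => LinearMap.ker (T.coaction.toLinearMap - (Polynomial.monomial n).restrictScalars ℂ))
    (by simp) (fun e r c hc x hx => by
      simp only [LinearMap.mem_ker, LinearMap.sub_apply, AlgHom.toLinearMap_apply,
        LinearMap.restrictScalars_apply, sub_eq_zero] at hx ⊢
      rw [map_mul, hx, T.coaction_ι hc, Polynomial.monomial_mul_monomial]) n hs
  simpa [sub_eq_zero] using h

theorem coeff_coaction_mem (s : T.SymC) (n : ℕ) : (T.coaction s).coeff n ∈ T.symGrade n := by
  induction s using SymmetricAlgebra.induction generalizing n with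
  | algebraMap r =>
    rw [AlgHom.commutes, Polynomial.algebraMap_apply, Polynomial.coeff_C]
    split_ifs with h
    · rw [h, Algebra.algebraMap_eq_smul_one]
      exact Submodule.smul_mem _ _ T.one_mem_symGrade
    · exact zero_mem _
  | ι c =>
    obtain ⟨p, rfl⟩ := T.proj_surjective c
    induction p using mon_induction with
    | zero => simp
    | add p q hp hq => simp only [map_add, Polynomial.coeff_add]; exact add_mem hp hq
    | mon k u =>
      rw [coaction_ι_proj, freeCoaction_mon, Polynomial.coeff_add, Polynomial.coeff_monomial,
        Polynomial.coeff_monomial]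
      refine add_mem ?_ ?_
      · split_ifs with h
        · subst h
          refine T.ι_mem_symGrade ?_
          rcases k with _ | k
          · exact T.gen_inl_mem _
          · exact T.mem_quotGrade_succ.2 ⟨_, T.proj_mon_d k _⟩
        · exact zero_mem _
      · split_ifs with h
        · subst h
          exact T.ι_mem_symGrade (T.mem_quotGrade_succ.2 ⟨_, rfl⟩)
        · exact zero_mem _
  | mul a b ha hb =>
    rw [map_mul, Polynomial.coeff_mul]
    refine sum_mem fun p hp => ?_
    have := T.mul_mem_symGrade _ _ _ _ (ha p.1) (hb p.2)
    rwa [Finset.HasAntidiagonal.mem_antidiagonal.1 hp] at this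
  | add a b ha hb => rw [map_add, Polynomial.coeff_add]; exact add_mem (ha n) (hb n)

theorem eval_one_coaction (s : T.SymC) : (T.coaction s).eval 1 = s := by
  induction s using SymmetricAlgebra.induction with
  | algebraMap r => rw [AlgHom.commutes, Polynomial.algebraMap_apply, Polynomial.eval_C]
  | ι c =>
    obtain ⟨p, rfl⟩ := T.proj_surjective c
    induction p using mon_induction with
    | zero => simp
    | add p q hp hq => simp only [map_add, Polynomial.eval_add, hp, hq]
    | mon k u =>
      rw [coaction_ι_proj, freeCoaction_mon, Polynomial.eval_add, Polynomial.eval_monomial,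
        Polynomial.eval_monomial, one_pow, one_pow, mul_one, mul_one, ← map_add, ← map_add,
        ← map_add, ← eq_inl_add_inr]
  | mul a b ha hb => rw [map_mul, Polynomial.eval_mul, ha, hb]
  | add a b ha hb => rw [map_add, Polynomial.eval_add, ha, hb]

theorem isInternal_symGrade : DirectSum.IsInternal T.symGrade := by
  classical
  constructor
  · rw [injective_iff_map_eq_zero]
    intro x hx
    have key : ∀ (x : DirectSum ℕ fun n => T.symGrade n) (n : ℕ),
        (T.coaction (DirectSum.coeAddMonoidHom T.symGrade x)).coeff n = (x n : T.SymC) := by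
      intro x n
      induction x using DirectSum.induction_on with
      | zero => simp
      | of i x =>
        rw [DirectSum.coeAddMonoidHom_of, T.coaction_of_mem x.2, Polynomial.coeff_monomial]
        by_cases h : i = n
        · subst h; simp
        · rw [if_neg h, DirectSum.of_eq_of_ne _ _ _ (Ne.symm h)]; rfl
      | add x y hx hy =>
        rw [map_add, map_add, Polynomial.coeff_add, hx, hy, DirectSum.add_apply,
          Submodule.coe_add]
    refine DFinsupp.ext fun n => Subtype.ext ?_
    rw [← key x n, hx, map_zero]
    rfl
  · intro s
    refine ⟨∑ n ∈ (T.coaction s).support, DirectSum.of (fun n => T.symGrade n) n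
      ⟨(T.coaction s).coeff n, T.coeff_coaction_mem s n⟩, ?_⟩
    simp only [map_sum, DirectSum.coeAddMonoidHom_of]
    conv_rhs => rw [← T.eval_one_coaction s, Polynomial.eval_eq_sum]
    simp [Polynomial.sum]

theorem isNGradedVertexPoissonAlgebra_prod :
    IsNGradedVertexPoissonAlgebra T.symD T.polarBracket.prod T.symGrade where
  toIsVertexPoissonAlgebra := T.isVertexPoissonAlgebra_prod
  isInternal := T.isInternal_symGrade
  one_mem := T.one_mem_symGrade
  mul_mem := T.mul_mem_symGrade
  d_mem := T.symD_mem_symGrade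
  prod_mem n r m k a b ha hb h := (T.pois_mem_polarGrade ha hb m).1 k (by omega)
  prod_eq_zero n r m a b ha hb h := (T.pois_mem_polarGrade ha hb m).2 (by omega)

end OneTruncatedConformalAlgebra


/-! ### The subalgebra `S(A)` and spanning sets of the homogeneous subspaces -/

namespace OneTruncatedConformalAlgebra

variable {A B : Type*} [AddCommGroup A] [Module ℂ A] [AddCommGroup B] [Module ℂ B]
variable (T : OneTruncatedConformalAlgebra A B)

/-- The projection `C(A ⊕ B) → A` that kills `D^k ⊗ a` for `k ≥ 1` and `D^k ⊗ b`. -/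
def freeRetraction : FreeC A B →ₗ[ℂ] A :=
  extendMon fun k => if k = 0 then LinearMap.fst ℂ A B else 0

theorem freeRetraction_eq_zero {p : FreeC A B} (hp : p ∈ LinearMap.range T.dHat) :
    freeRetraction p = 0 := by
  refine T.range_dHat_induction (motive := fun p => freeRetraction p = 0)
    (by simp) (fun p p' hp hp' => by simp [hp, hp']) (fun m a => ?_) hp
  rw [map_sub, freeRetraction, extendMon_mon, extendMon_mon]
  by_cases h : m = 0 <;> simp [h]

/-- The retraction `𝒞 → A` of `A → 𝒞`. -/
def retraction : T.QuotC →ₗ[ℂ] A :=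
  (LinearMap.range T.dHat).liftQ freeRetraction fun _ hp => T.freeRetraction_eq_zero hp

theorem retraction_gen_inl (a : A) : T.retraction (T.gen (a, 0)) = a := by
  have h : T.retraction (T.gen (a, 0)) = freeRetraction (mon A B 0 (a, 0)) := rfl
  rw [h, freeRetraction, extendMon_mon]
  simp

theorem inA_apply (a : A) : T.inA a = SymmetricAlgebra.ι ℂ T.QuotC (T.gen (a, 0)) := rfl

theorem inB_apply (n : ℕ) (b : B) :
    T.inB n b = SymmetricAlgebra.ι ℂ T.QuotC (T.proj (mon A B n (0, b))) := rfl

theorem inA_mem_symGrade (a : A) : T.inA a ∈ T.symGrade 0 :=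
  T.ι_mem_symGrade (T.gen_inl_mem a)

theorem inB_mem_symGrade (n : ℕ) (b : B) : T.inB n b ∈ T.symGrade (n + 1) :=
  T.ι_mem_symGrade (T.mem_quotGrade_succ.2 ⟨b, rfl⟩)

/-- The map `S(A) → S(𝒞)` is split by the map induced by `retraction`. -/
theorem lift_inA_injective : Function.Injective (SymmetricAlgebra.lift T.inA) := by
  have h : (SymmetricAlgebra.lift (SymmetricAlgebra.ι ℂ A ∘ₗ T.retraction)).comp
      (SymmetricAlgebra.lift T.inA) = AlgHom.id ℂ _ := by
    apply SymmetricAlgebra.algHom_ext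
    refine LinearMap.ext fun a => ?_
    simp [inA_apply, retraction_gen_inl]
  exact Function.LeftInverse.injective fun s =>
    congrArg (fun f : SymmetricAlgebra ℂ A →ₐ[ℂ] SymmetricAlgebra ℂ A => f s) h

theorem range_lift_inA :
    LinearMap.range (SymmetricAlgebra.lift T.inA).toLinearMap = T.symGrade 0 := by
  apply le_antisymm
  · rintro _ ⟨s, rfl⟩
    rw [AlgHom.toLinearMap_apply]
    induction s using SymmetricAlgebra.induction with
    | algebraMap r =>
      rw [AlgHom.commutes, Algebra.algebraMap_eq_smul_one]
      exact Submodule.smul_mem _ _ T.one_mem_symGrade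
    | ι a => rw [SymmetricAlgebra.lift_ι_apply]; exact T.inA_mem_symGrade a
    | mul a b ha hb => rw [map_mul]; exact T.mul_mem_symGrade 0 0 _ _ ha hb
    | add a b ha hb => rw [map_add]; exact add_mem ha hb
  · -- no condition is needed in positive degrees
    refine T.symGrade_le
      (fun n => if n = 0 then LinearMap.range (SymmetricAlgebra.lift T.inA).toLinearMap else ⊤)
      ?_ ?_ 0
    · exact ⟨1, by simp⟩
    · intro e r c hc x hx
      rcases Nat.eq_zero_or_pos (e + r) with h | h
      · obtain ⟨rfl, rfl⟩ := Nat.add_eq_zero_iff.1 h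
        obtain ⟨a, rfl⟩ := T.mem_quotGrade_zero.1 hc
        obtain ⟨s, rfl⟩ := hx
        exact ⟨SymmetricAlgebra.ι ℂ A a * s, by simp [inA_apply]⟩
      · rw [if_neg h.ne']
        trivial

/-- The monomials `D^{n_1} b_1 ⋯ D^{n_k} b_k a_1 ⋯ a_l` of degree `n`, the `n_i` in any order. -/
def monomials (n : ℕ) : Set T.SymC :=
  {s | ∃ (k l : ℕ) (e : Fin k → ℕ) (b : Fin k → B) (a : Fin l → A),
    ∑ i, e i + k = n ∧ s = (∏ i, T.inB (e i) (b i)) * ∏ j, T.inA (a j)}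

theorem symGrade_le_span_monomials (n : ℕ) :
    T.symGrade n ≤ Submodule.span ℂ (T.monomials n) := by
  refine T.symGrade_le (fun n => Submodule.span ℂ (T.monomials n)) ?_ ?_ n
  · exact Submodule.subset_span ⟨0, 0, Fin.elim0, Fin.elim0, Fin.elim0, by simp, by simp⟩
  · intro m r c hc x hx
    induction hx using Submodule.span_induction with
    | zero => rw [mul_zero]; exact zero_mem _
    | add x y _ _ hx hy => rw [mul_add]; exact add_mem hx hy
    | smul r x _ hx => rw [mul_smul_comm]; exact Submodule.smul_mem _ _ hx
    | mem x hx =>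
      obtain ⟨k, l, e, b, a, rfl, rfl⟩ := hx
      refine Submodule.subset_span ?_
      rcases m with _ | m
      · obtain ⟨a₀, rfl⟩ := T.mem_quotGrade_zero.1 hc
        refine ⟨k, l + 1, e, b, Fin.cons a₀ a, by simp, ?_⟩
        rw [← inA_apply, Fin.prod_univ_succ (fun j => T.inA _)]
        simp only [Fin.cons_zero, Fin.cons_succ]
        ring
      · obtain ⟨b₀, rfl⟩ := T.mem_quotGrade_succ.1 hc
        refine ⟨k + 1, l, Fin.cons m e, Fin.cons b₀ b, a, ?_, ?_⟩
        · simp only [Fin.sum_univ_succ, Fin.cons_zero, Fin.cons_succ]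
          ring
        · rw [← inB_apply, Fin.prod_univ_succ (fun i => T.inB _ _)]
          simp only [Fin.cons_zero, Fin.cons_succ]
          ring

theorem symGrade_eq_span (n : ℕ) (hn : 1 ≤ n) : T.symGrade n =
    Submodule.span ℂ {s | ∃ (k l : ℕ) (e : Fin k → ℕ) (b : Fin k → B) (a : Fin l → A),
      1 ≤ k ∧ Antitone e ∧ ∑ i, e i + k = n ∧
        s = (∏ i, T.inB (e i) (b i)) * ∏ j, T.inA (a j)} := by
  apply le_antisymm
  · refine (T.symGrade_le_span_monomials n).trans (Submodule.span_mono ?_)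
    rintro _ ⟨k, l, e, b, a, hsum, rfl⟩
    -- sort the exponents into decreasing order
    let σ := Tuple.sort (OrderDual.toDual ∘ e)
    have hσ : Antitone (e ∘ σ) := fun i j hij => Tuple.monotone_sort (OrderDual.toDual ∘ e) hij
    refine ⟨k, l, e ∘ σ, b ∘ σ, a, ?_, hσ, ?_, ?_⟩
    · rcases k with _ | k
      · simp only [Finset.univ_eq_empty, Finset.sum_empty, add_zero] at hsum
        omega
      · omega
    · rw [← hsum, ← Equiv.sum_comp σ e]
      rfl
    · rw [← Equiv.prod_comp σ fun i => T.inB (e i) (b i)]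
      rfl
  · refine Submodule.span_le.2 ?_
    rintro _ ⟨k, l, e, b, a, -, -, rfl, rfl⟩
    have h1 := T.prod_mem_symGrade Finset.univ (fun i => T.inB (e i) (b i)) (fun i => e i + 1)
      fun i _ => T.inB_mem_symGrade _ _
    have h2 := T.prod_mem_symGrade Finset.univ (fun j => T.inA (a j)) (fun _ => 0)
      fun j _ => T.inA_mem_symGrade _
    have h := T.mul_mem_symGrade _ _ _ _ h1 h2
    simpa [Finset.sum_add_distrib] using h

end OneTruncatedConformalAlgebra

end

theorem theorem4p15 {A B : Type*} [AddCommGroup A] [Module ℂ A] [AddCommGroup B] [Module ℂ B]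
    (T : OneTruncatedConformalAlgebra A B) :
    -- `Y^0_-` extends in exactly one way to a vertex Poisson algebra structure on
    -- `(S(𝒞), D)`, and this one is `ℕ`-graded
    (∃ Y : ℕ → T.SymC →ₗ[ℂ] T.SymC →ₗ[ℂ] T.SymC,
      T.ExtendsY0 Y ∧
      IsNGradedVertexPoissonAlgebra T.symD Y T.symGrade ∧
      ∀ Y' : ℕ → T.SymC →ₗ[ℂ] T.SymC →ₗ[ℂ] T.SymC,
        T.ExtendsY0 Y' → IsVertexPoissonAlgebra T.symD Y' → Y' = Y) ∧
    -- the canonical map `S(A) → S(𝒞)` identifies `S(A)` with the degree-zero part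
    (Function.Injective (SymmetricAlgebra.lift T.inA) ∧
      LinearMap.range (SymmetricAlgebra.lift T.inA).toLinearMap = T.symGrade 0) ∧
    -- the part of degree `n ≥ 1`
    (∀ n : ℕ, 1 ≤ n → T.symGrade n =
      Submodule.span ℂ {s | ∃ (k l : ℕ) (e : Fin k → ℕ) (b : Fin k → B) (a : Fin l → A),
        1 ≤ k ∧ Antitone e ∧ ∑ i, e i + k = n ∧
          s = (∏ i, T.inB (e i) (b i)) * ∏ j, T.inA (a j)}) := by
  refine ⟨⟨T.polarBracket.prod, T.extendsY0_prod, T.isNGradedVertexPoissonAlgebra_prod,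
    fun Y' hext hY' => hY'.eq_of_eq_on_generators T.isVertexPoissonAlgebra_prod fun n v w => ?_⟩,
    ⟨T.lift_inA_injective, T.range_lift_inA⟩, T.symGrade_eq_span⟩
  obtain ⟨p, rfl⟩ := T.proj_surjective v
  obtain ⟨q, rfl⟩ := T.proj_surjective w
  rw [hext, T.extendsY0_prod]
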